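/- Let $d\ge 1$ and let $Y=(Y_t)_{t\ge 0}$ be a Lévy process in $\mathbb{R}^d$ with generating triplet $(A,N,b)$: $A$ is a symmetric non-negative definite $d\times d$ matrix, $b\in\mathbb{R}^d$, $N$ is a Lévy measure (a Borel measure with $N(\{0\})=0$ and $\int_{\mathbb{R}^d}(1\wedge|z|^2)\,N(dz)<\infty$), and $\mathbb{E}\,e^{i\langle x,Y_t\rangle}=e^{-t\psi(x)}$ for all $t\ge0$, $x\in\mathbb{R}^d$, where $$\psi(x)=\langle x,Ax\rangle-i\langle x,b\rangle-\int_{\mathbb{R}^d}\left(e^{i\langle x,z\rangle}-1-i\langle x,z\rangle\mathbf{1}_{|z|<1}\right)N(dz).$$ For $r>0$ put $$h(r)=r^{-2}\|A\|+\int_{\mathbb{R}^d}\left(1\wedge\frac{|z|^2}{r^2}\right)N(dz),$$ where $\|A\|$ is the operator norm of $A$ with respect to the Euclidean norm, and for $r\ge 0$ put $\psi^*(r)=\sup_{|z|\le r}\mathrm{Re}\,\psi(z)$. Assume that $h(0^+)=\infty$; then $h$ is a decreasing bijection of $(0,\infty)$ onto itself, with inverse $h^{-1}$. Then the following conditions are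 equivalent. (D1) There are $T_1,c_1>0$ such that for all $t>T_1$ the law of $Y_t$ has a density $p(t,\cdot)$ with respect to Lebesgue measure and (for a suitable version of it) $$\sup_{x\in\mathbb{R}^d}p(t,x)\le c_1\,[h^{-1}(1/t)]^{-d}.$$ (D2) There are $T_2,c_2>0$ such that for all $t>T_2$, $$\int_{\mathbb{R}^d}e^{-t\,\mathrm{Re}\,\psi(z)}\,dz\le c_2\,[h^{-1}(1/t)]^{-d}.$$ (D3) There are $T_3>0$, $c_3\in(0,1]$ and $\alpha_3\in(0,2]$ such that $$c_3\,\psi^*(|x|)\le\mathrm{Re}\,\psi(x)\quad\text{for all } x\in\mathbb{R}^d \text{ with } |x|<1/T_3,$$ $$\psi^*(\lambda r)\le\frac1{c_3}\,\lambda^{\alpha_3}\,\psi^*(r)\quad\text{for all } 0<\lambda\le1,\ 0<r<1/T_3,$$ and, in addition, $e^{-t_0\psi}\in L^1(\mathbb{R}^d)$ for some $t_0>0$. (D4) There are $T_4>0$ and $c_4\in[1,\infty)$ such that for all $x\in\mathbb{R}^d$ with $|x|<1/T_4$, $$\psi^*(|x|)\le c_4\left(\langle x,Ax\rangle+\int_{|\langle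 x,z\rangle|<1}|\langle x,z\rangle|^2\,N(dz)\right),$$ and, in addition, $e^{-t_0\psi}\in L^1(\mathbb{R}^d)$ for some $t_0>0$. -/

import Mathlib

open MeasureTheory ProbabilityTheory Filter Topology
open scoped NNReal ENNReal

/-- A generating triplet `(A, N, b)` on `ℝ^d`: a symmetric non-negative definite matrix `A`,
a Lévy measure `N` and a vector `b`. -/
structure LevyTriplet (d : ℕ) where
  A : Matrix (Fin d) (Fin d) ℝ
  N : Measure (EuclideanSpace ℝ (Fin d))
  b : EuclideanSpace ℝ (Fin d)
  posSemidef_A : A.PosSemidef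
  N_singleton_zero : N {0} = 0
  lintegral_N_lt_top : ∫⁻ z, ENNReal.ofReal (min 1 (‖z‖ ^ 2)) ∂N < ∞

namespace LevyTriplet

variable {d : ℕ}

/-- The quadratic form `⟨x, A x⟩`. -/
noncomputable def quadForm (τ : LevyTriplet d) (x : EuclideanSpace ℝ (Fin d)) : ℝ :=
  inner ℝ x (Matrix.toEuclideanCLM (n := Fin d) (𝕜 := ℝ) τ.A x)

/-- The characteristic exponent
`ψ(x) = ⟨x, A x⟩ - i ⟨x, b⟩ - ∫ (exp (i ⟨x, z⟩) - 1 - i ⟨x, z⟩ 1_{|z| < 1}) N(dz)`. -/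
noncomputable def charExponent (τ : LevyTriplet d) (x : EuclideanSpace ℝ (Fin d)) : ℂ :=
  (τ.quadForm x : ℂ) - Complex.I * ((inner ℝ x τ.b : ℝ) : ℂ)
    - ∫ z, (Complex.exp (Complex.I * ((inner ℝ x z : ℝ) : ℂ)) - 1
        - if ‖z‖ < 1 then Complex.I * ((inner ℝ x z : ℝ) : ℂ) else 0) ∂τ.N

/-- The majorant `ψ*(r) = sup_{|z| ≤ r} Re ψ(z)`. -/
noncomputable def charExponentStar (τ : LevyTriplet d) (r : ℝ) : ℝ :=
  sSup ((fun z => (τ.charExponent z).re) '' Metric.closedBall 0 r)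

/-- The concentration function `h(r) = r⁻² ‖A‖ + ∫ (1 ∧ |z|² / r²) N(dz)`, `r > 0`, with `‖A‖` the
operator norm with respect to the Euclidean norm. -/
noncomputable def h (τ : LevyTriplet d) (r : ℝ) : ℝ :=
  ‖Matrix.toEuclideanCLM (n := Fin d) (𝕜 := ℝ) τ.A‖ / r ^ 2
    + ∫ z, min 1 (‖z‖ ^ 2 / r ^ 2) ∂τ.N

/-- The inverse of `h : (0, ∞) → (0, ∞)` (a bijection whenever `h(0+) = ∞`). -/
noncomputable def hInv (τ : LevyTriplet d) (u : ℝ) : ℝ :=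
  Function.invFunOn τ.h (Set.Ioi 0) u

end LevyTriplet

/-- A Lévy process in `ℝ^d`: it starts at `0` almost surely, has independent and stationary
increments, is stochastically continuous, and almost surely has càdlàg paths. -/
structure IsLevyProcess {d : ℕ} {Ω : Type*} [MeasurableSpace Ω] (P : Measure Ω)
    (Y : ℝ≥0 → Ω → EuclideanSpace ℝ (Fin d)) : Prop where
  measurable : ∀ t, Measurable (Y t)
  zero : ∀ᵐ ω ∂P, Y 0 ω = 0
  indep_increments : HasIndepIncrements Y P
  stationary_increments : ∀ s t, IdentDistrib (Y (s + t) - Y s) (Y t) P P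
  continuous_in_measure : ∀ t, TendstoInMeasure P Y (𝓝 t) (Y t)
  cadlag : ∀ᵐ ω ∂P, ∀ t : ℝ≥0,
    ContinuousWithinAt (fun s => Y s ω) (Set.Ici t) t ∧
      ∃ l, Tendsto (fun s => Y s ω) (𝓝[<] t) (𝓝 l)

/-- `τ` is the generating triplet of `Y`: `E exp (i ⟨x, Y_t⟩) = exp (-t ψ(x))`. -/
def HasGeneratingTriplet {d : ℕ} {Ω : Type*} [MeasurableSpace Ω] (P : Measure Ω)
    (Y : ℝ≥0 → Ω → EuclideanSpace ℝ (Fin d)) (τ : LevyTriplet d) : Prop :=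
  ∀ (t : ℝ≥0) (x : EuclideanSpace ℝ (Fin d)),
    charFun (P.map (Y t)) x = Complex.exp (-((t : ℝ) : ℂ) * τ.charExponent x)

/-- `p` is a density of the random vector `X` with respect to Lebesgue measure. -/
def IsDensityOf {d : ℕ} {Ω : Type*} [MeasurableSpace Ω] (P : Measure Ω)
    (X : Ω → EuclideanSpace ℝ (Fin d)) (p : EuclideanSpace ℝ (Fin d) → ℝ≥0∞) : Prop :=
  Measurable p ∧ P.map X = (volume : Measure (EuclideanSpace ℝ (Fin d))).withDensity p

/-!
The theorem is reduced to statements about `φ = Re ψ`, which by `LevyTriplet.re_charExponent` is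
`φ(x) = ⟨x, A x⟩ + ∫ (1 - cos ⟨x, z⟩) N(dz)`. Two facts about `φ` carry the argument.

* `ψ*(r)` is comparable with `h(1/r)` (`charExponentStar_le_h`, `h_le_charExponentStar`). The lower
  bound averages `φ` over segments along the coordinate axes, which removes the zeros of `1 - cos`.
* `φ(k x) ≤ k² φ(x)` and `φ(x + y) ≤ 2 φ(x) + 2 φ(y)`. Hence, if `φ(x)` is tiny, `φ` is bounded on
  many disjoint balls centred at multiples of `x`, and `∫ exp (-t φ)` is large
  (`one_lt_mul_reExponent`).

The density bound and the integral bound are linked by Fourier analysis with Gaussian weights. If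
the characteristic function is integrable, testing the law against Gaussians bounds the mass of each
ball by a multiple of its volume, and the Besicovitch covering theorem turns this into a bounded
density. Conversely a density bounded by `M` gives `∫ exp (-2 t φ) ≤ (2π)ᵈ M`. The factor `2` is
removed by `exists_mul_h_le`: an integral bound by `h⁻¹(1/t)⁻ᵈ` forces `h(c r) ≥ k h(r)` for large
`r`, because the ball of radius `1 / h⁻¹(k/t)` alone contributes a multiple of `h⁻¹(k/t)⁻ᵈ`.

The same inequality derives the power scaling of `ψ*` from the integral bound, by iterating
`ψ*(c r) ≤ ψ*(r) / 2`; the pointwise bound `c ψ*(|x|) ≤ φ(x)` is the packing argument at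
`t = 1 / h(1/|x|)`. For the converse, scaling bounds `exp (-t φ(z))` near the
origin by a stretched exponential in `h⁻¹(1/t) |z|`, while away from the origin `φ` is bounded below, again by packing, so that the
remaining part decays exponentially in `t`, against the polynomial growth of `h⁻¹(1/t)`.

The scaling conditions and the bound by small jumps are compared through `f(x) = ⟨x, A x⟩ + ∫ (1 ∧
⟨x, z⟩²) N(dz)` and its small-jump part `g(x)`. Under the scaling conditions, `f(s x) ≥ 2 f(x)` for
a fixed large `s`, whereas always `f(s x) ≤ f(x) + s² g(x)`; so `f(x) ≤ s² g(x)`. Under the bound by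
small jumps, the pointwise bound holds as `g ≤ 5 φ`, and `g(x) ≤ (4/3) (f(x) - f(x/2))` telescopes,
so that `∑ₖ ψ*(2⁻ᵏ r)` is at most a multiple of `ψ*(r)`, which forces `ψ*` to halve after a fixed
number of dyadic steps.
-/

/-! ### Elementary trigonometric inequalities -/

lemma one_sub_cos_nat_mul_le (n : ℕ) (u : ℝ) :
    1 - Real.cos (n * u) ≤ (n : ℝ) ^ 2 * (1 - Real.cos u) := by
  have hsin : ∀ v : ℝ, |Real.sin (n * v)| ≤ n * |Real.sin v| := by
    intro v
    induction n with
    | zero => simp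
    | succ n ih =>
      push_cast
      rw [add_mul, one_mul, Real.sin_add]
      calc |Real.sin (n * v) * Real.cos v + Real.cos (n * v) * Real.sin v|
          ≤ |Real.sin (n * v)| * |Real.cos v| + |Real.cos (n * v)| * |Real.sin v| := by
            simpa only [abs_mul] using
              abs_add_le (Real.sin (n * v) * Real.cos v) (Real.cos (n * v) * Real.sin v)
        _ ≤ |Real.sin (n * v)| * 1 + 1 * |Real.sin v| := by
            gcongr <;> exact Real.abs_cos_le_one _
        _ ≤ (n + 1) * |Real.sin v| := by linarith
  have hcos : ∀ v : ℝ, 1 - Real.cos (2 * v) = 2 * Real.sin v ^ 2 := fun v => by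
    rw [Real.cos_two_mul, Real.cos_sq']; ring
  have h := hsin (u / 2)
  have h2 : Real.sin (n * (u / 2)) ^ 2 ≤ (n * |Real.sin (u / 2)|) ^ 2 := by
    rw [← sq_abs (Real.sin (n * (u / 2)))]
    gcongr
  rw [mul_pow, sq_abs] at h2
  have e1 := hcos (n * (u / 2))
  have e2 := hcos (u / 2)
  rw [show 2 * (n * (u / 2)) = n * u by ring] at e1
  rw [show 2 * (u / 2) = u by ring] at e2
  rw [e1, e2]
  linarith

lemma one_sub_cos_add_le (u v : ℝ) :
    1 - Real.cos (u + v) ≤ 2 * (1 - Real.cos u) + 2 * (1 - Real.cos v) := by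
  have hcos : ∀ v : ℝ, 1 - Real.cos (2 * v) = 2 * Real.sin v ^ 2 := fun v => by
    rw [Real.cos_two_mul, Real.cos_sq']; ring
  have e1 := hcos ((u + v) / 2)
  have e2 := hcos (u / 2)
  have e3 := hcos (v / 2)
  rw [show 2 * ((u + v) / 2) = u + v by ring] at e1
  rw [show 2 * (u / 2) = u by ring] at e2
  rw [show 2 * (v / 2) = v by ring] at e3
  rw [e1, e2, e3, show (u + v) / 2 = u / 2 + v / 2 by ring, Real.sin_add]
  set a := Real.sin (u / 2)
  set b := Real.sin (v / 2)
  have hc : Real.cos (v / 2) ^ 2 ≤ 1 := Real.cos_sq_le_one _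
  have hd : Real.cos (u / 2) ^ 2 ≤ 1 := Real.cos_sq_le_one _
  nlinarith [sq_nonneg (a * Real.cos (v / 2) - Real.cos (u / 2) * b),
    mul_nonneg (sq_nonneg a) (sub_nonneg.2 hc), mul_nonneg (sq_nonneg b) (sub_nonneg.2 hd)]

lemma one_sub_cos_le_two_mul_min (u : ℝ) : 1 - Real.cos u ≤ 2 * min 1 (u ^ 2) := by
  rw [mul_min_of_nonneg _ _ zero_le_two, le_min_iff]
  constructor
  · linarith [Real.neg_one_le_cos u]
  · nlinarith [Real.one_sub_sq_div_two_le_cos (x := u), sq_nonneg u]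

lemma sq_le_five_mul_one_sub_cos {u : ℝ} (hu : |u| ≤ Real.pi) :
    u ^ 2 ≤ 5 * (1 - Real.cos u) := by
  have h := Real.cos_le_one_sub_mul_cos_sq hu
  have hpi : Real.pi ^ 2 ≤ 10 := by nlinarith [Real.pi_lt_d2, Real.pi_pos]
  have h2 : u ^ 2 / 5 ≤ 2 / Real.pi ^ 2 * u ^ 2 := by
    rw [div_mul_eq_mul_div, div_le_div_iff₀ (by norm_num) (by positivity)]
    nlinarith [sq_nonneg u]
  linarith

/-- Averaging `1 - cos (s u)` over `s ∈ [0, 1]` removes the zeros of `1 - cos`. -/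
lemma min_one_sq_le_integral_one_sub_cos (u : ℝ) :
    min 1 (u ^ 2) ≤ 15 * ∫ s in (0 : ℝ)..1, (1 - Real.cos (s * u)) := by
  by_cases hu : |u| ≤ Real.pi
  · refine (min_le_right _ _).trans ?_
    have hmono : ∫ s in (0 : ℝ)..1, s ^ 2 * (u ^ 2 / 5)
        ≤ ∫ s in (0 : ℝ)..1, (1 - Real.cos (s * u)) := by
      refine intervalIntegral.integral_mono_on zero_le_one
        (Continuous.intervalIntegrable (by fun_prop) _ _)
        (Continuous.intervalIntegrable (by fun_prop) _ _) fun s hs => ?_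
      have := sq_le_five_mul_one_sub_cos (u := s * u) (by
        rw [abs_mul, abs_of_nonneg hs.1]
        nlinarith [abs_nonneg u, hs.2])
      nlinarith
    rw [intervalIntegral.integral_mul_const, integral_pow] at hmono
    norm_num at hmono
    linarith
  · push Not at hu
    have hu0 : u ≠ 0 := by
      rintro rfl
      simp at hu
      linarith [Real.pi_pos]
    refine (min_le_left _ _).trans ?_
    rw [intervalIntegral.integral_sub (Continuous.intervalIntegrable (by fun_prop) _ _)
      (Continuous.intervalIntegrable (by fun_prop) _ _),
      intervalIntegral.integral_comp_mul_right (fun x => Real.cos x) hu0]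
    simp only [intervalIntegral.integral_const, sub_zero, smul_eq_mul, mul_one, zero_mul, one_mul,
      integral_cos, Real.sin_zero]
    have h1 : u⁻¹ * Real.sin u ≤ 1 / 2 := by
      refine (le_abs_self _).trans ?_
      rw [abs_mul, abs_inv]
      have h3 : |u|⁻¹ ≤ 1 / 2 := by
        rw [← one_div]
        exact one_div_le_one_div_of_le two_pos (by linarith [Real.pi_gt_three])
      nlinarith [Real.abs_sin_le_one u, abs_nonneg (Real.sin u), inv_nonneg.2 (abs_nonneg u)]
    linarith

lemma norm_cexp_I_mul_sub_one_sub_le (u : ℝ) :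
    ‖Complex.exp (Complex.I * u) - 1 - Complex.I * u‖ ≤ 3 * u ^ 2 := by
  by_cases hu : |u| ≤ 1
  · have h := Complex.norm_exp_sub_one_sub_id_le (x := Complex.I * u) (by simpa using hu)
    simp only [norm_mul, Complex.norm_I, one_mul, Complex.norm_real, Real.norm_eq_abs,
      sq_abs] at h
    nlinarith [sq_nonneg u]
  · push Not at hu
    have h1 : ‖Complex.exp (Complex.I * u)‖ = 1 := by
      rw [mul_comm]; exact Complex.norm_exp_ofReal_mul_I u
    have h2 : ‖Complex.I * (u : ℂ)‖ = |u| := by simp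
    calc ‖Complex.exp (Complex.I * u) - 1 - Complex.I * u‖
        ≤ ‖Complex.exp (Complex.I * u)‖ + ‖(1 : ℂ)‖ + ‖Complex.I * (u : ℂ)‖ :=
          (norm_sub_le _ _).trans (add_le_add_left (norm_sub_le _ _) _)
      _ = 2 + |u| := by rw [h1, h2, norm_one]; ring
      _ ≤ 3 * u ^ 2 := by rw [← sq_abs u]; nlinarith

namespace LevyTriplet

variable {d : ℕ}

/-! ### The real part of the characteristic exponent -/

lemma integrable_min_one_norm_sq (τ : LevyTriplet d) :
    Integrable (fun z => min 1 (‖z‖ ^ 2)) τ.N := by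
  refine ⟨(by fun_prop : Continuous fun z : EuclideanSpace ℝ (Fin d) =>
    min (1 : ℝ) (‖z‖ ^ 2)).aestronglyMeasurable, ?_⟩
  rw [hasFiniteIntegral_iff_ofReal (ae_of_all _ fun z => by positivity)]
  exact τ.lintegral_N_lt_top

lemma integrable_of_norm_le (τ : LevyTriplet d) {F : Type*} [NormedAddCommGroup F]
    {f : EuclideanSpace ℝ (Fin d) → F} (hf : AEStronglyMeasurable f τ.N) (C : ℝ)
    (hC : ∀ z, ‖f z‖ ≤ C * min 1 (‖z‖ ^ 2)) : Integrable f τ.N :=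
  (τ.integrable_min_one_norm_sq.const_mul C).mono' hf (ae_of_all _ hC)

instance sigmaFinite_N (τ : LevyTriplet d) : SigmaFinite τ.N := by
  refine Measure.sigmaFinite_of_countable (S := insert {0} (Set.range fun n : ℕ =>
    {z : EuclideanSpace ℝ (Fin d) | 1 / ((n : ℝ) + 1) < min 1 (‖z‖ ^ 2)}))
    ((Set.countable_range _).insert _) ?_ ?_
  · rintro s (rfl | ⟨n, rfl⟩)
    · simp [τ.N_singleton_zero]
    · exact τ.integrable_min_one_norm_sq.measure_gt_lt_top (by positivity)
  · refine Set.eq_univ_of_forall fun z => ?_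
    by_cases hz : z = 0
    · exact ⟨{0}, Set.mem_insert _ _, hz⟩
    · obtain ⟨n, hn⟩ := exists_nat_one_div_lt (K := ℝ) (ε := min 1 (‖z‖ ^ 2))
        (by have := norm_pos_iff.2 hz; positivity)
      exact ⟨_, Set.mem_insert_of_mem _ ⟨n, rfl⟩, hn⟩

lemma min_one_mul_le {c x : ℝ} (hx : 0 ≤ x) : min 1 (c * x) ≤ max 1 c * min 1 x := by
  rw [mul_min_of_nonneg _ _ (by positivity), le_min_iff]
  constructor
  · exact (min_le_left _ _).trans (by simp)
  · refine (min_le_right _ _).trans ?_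
    gcongr
    exact le_max_right _ _

lemma inner_sq_le (x z : EuclideanSpace ℝ (Fin d)) :
    (inner ℝ x z : ℝ) ^ 2 ≤ ‖x‖ ^ 2 * ‖z‖ ^ 2 := by
  rw [← mul_pow, ← sq_abs]
  gcongr
  exact abs_real_inner_le_norm x z

lemma integrable_min_one_mul_norm_sq (τ : LevyTriplet d) {c : ℝ} (hc : 0 ≤ c) :
    Integrable (fun z => min 1 (c * ‖z‖ ^ 2)) τ.N := by
  refine τ.integrable_of_norm_le (Continuous.aestronglyMeasurable (by fun_prop)) (max 1 c)
    fun z => ?_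
  rw [Real.norm_of_nonneg (by positivity)]
  exact min_one_mul_le (by positivity)

lemma integrable_min_one_inner_sq (τ : LevyTriplet d) (x : EuclideanSpace ℝ (Fin d)) :
    Integrable (fun z => min 1 ((inner ℝ x z : ℝ) ^ 2)) τ.N := by
  refine (τ.integrable_min_one_mul_norm_sq (sq_nonneg ‖x‖)).mono'
    (Continuous.aestronglyMeasurable (by fun_prop)) (ae_of_all _ fun z => ?_)
  rw [Real.norm_of_nonneg (by positivity)]
  exact min_le_min_left _ (inner_sq_le x z)

lemma integrable_one_sub_cos_inner (τ : LevyTriplet d) (x : EuclideanSpace ℝ (Fin d)) :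
    Integrable (fun z => 1 - Real.cos (inner ℝ x z)) τ.N := by
  refine ((τ.integrable_min_one_inner_sq x).const_mul 2).mono'
    (Continuous.aestronglyMeasurable (by fun_prop)) (ae_of_all _ fun z => ?_)
  rw [Real.norm_of_nonneg (by linarith [Real.cos_le_one (inner ℝ x z)])]
  exact one_sub_cos_le_two_mul_min _

/-- The real part of the characteristic exponent, `⟨x, A x⟩ + ∫ (1 - cos ⟨x, z⟩) N(dz)`. -/
noncomputable def reExponent (τ : LevyTriplet d) (x : EuclideanSpace ℝ (Fin d)) : ℝ :=
  τ.quadForm x + ∫ z, (1 - Real.cos (inner ℝ x z)) ∂τ.N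

lemma re_charExponent (τ : LevyTriplet d) (x : EuclideanSpace ℝ (Fin d)) :
    (τ.charExponent x).re = τ.reExponent x := by
  have hint : Integrable (fun z => Complex.exp (Complex.I * ((inner ℝ x z : ℝ) : ℂ)) - 1
        - if ‖z‖ < 1 then Complex.I * ((inner ℝ x z : ℝ) : ℂ) else 0) τ.N := by
    refine τ.integrable_of_norm_le (C := 2 + 3 * ‖x‖ ^ 2) ?_ fun z => ?_
    · refine AEStronglyMeasurable.sub (Continuous.aestronglyMeasurable (by fun_prop)) ?_
      refine Measurable.aestronglyMeasurable ?_
      exact Measurable.ite (measurableSet_lt measurable_norm measurable_const)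
        (by fun_prop) measurable_const
    · by_cases hz : ‖z‖ < 1
      · rw [if_pos hz, min_eq_right (by nlinarith [norm_nonneg z])]
        refine (norm_cexp_I_mul_sub_one_sub_le _).trans ?_
        nlinarith [inner_sq_le x z, sq_nonneg ‖z‖]
      · rw [if_neg hz, min_eq_left (by nlinarith [not_lt.1 hz]), sub_zero]
        refine (norm_sub_le _ _).trans ?_
        rw [mul_comm, Complex.norm_exp_ofReal_mul_I, norm_one]
        nlinarith [sq_nonneg ‖x‖]
  have hre : (∫ z, (Complex.exp (Complex.I * ((inner ℝ x z : ℝ) : ℂ)) - 1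
        - if ‖z‖ < 1 then Complex.I * ((inner ℝ x z : ℝ) : ℂ) else 0) ∂τ.N).re
      = ∫ z, (Real.cos (inner ℝ x z) - 1) ∂τ.N := by
    have := integral_re hint
    simp only [RCLike.re_eq_complex_re] at this
    rw [← this]
    congr 1 with z
    have : (Complex.exp (Complex.I * ((inner ℝ x z : ℝ) : ℂ))).re = Real.cos (inner ℝ x z) := by
      rw [mul_comm, Complex.exp_ofReal_mul_I_re]
    split_ifs <;> simp [this]
  have hneg : ∫ z, (Real.cos (inner ℝ x z) - 1) ∂τ.N
      = - ∫ z, (1 - Real.cos (inner ℝ x z)) ∂τ.N := by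
    rw [← integral_neg]
    congr 1 with z
    ring
  rw [charExponent, Complex.sub_re, Complex.sub_re, hre, hneg, reExponent]
  simp

lemma quadForm_nonneg (τ : LevyTriplet d) (x : EuclideanSpace ℝ (Fin d)) :
    0 ≤ τ.quadForm x := by
  rw [quadForm, Matrix.inner_toEuclideanCLM]
  simpa using τ.posSemidef_A.dotProduct_mulVec_nonneg (x := WithLp.ofLp x)

lemma quadForm_smul (τ : LevyTriplet d) (c : ℝ) (x : EuclideanSpace ℝ (Fin d)) :
    τ.quadForm (c • x) = c ^ 2 * τ.quadForm x := by
  simp only [quadForm, map_smul, inner_smul_left, inner_smul_right]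
  simp
  ring

lemma quadForm_add_add_quadForm_sub (τ : LevyTriplet d) (x y : EuclideanSpace ℝ (Fin d)) :
    τ.quadForm (x + y) + τ.quadForm (x - y) = 2 * τ.quadForm x + 2 * τ.quadForm y := by
  simp only [quadForm, map_add, map_sub, inner_add_left, inner_add_right, inner_sub_left,
    inner_sub_right]
  ring

lemma quadForm_add_le (τ : LevyTriplet d) (x y : EuclideanSpace ℝ (Fin d)) :
    τ.quadForm (x + y) ≤ 2 * τ.quadForm x + 2 * τ.quadForm y := by
  linarith [τ.quadForm_add_add_quadForm_sub x y, τ.quadForm_nonneg (x - y)]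

lemma quadForm_le (τ : LevyTriplet d) (x : EuclideanSpace ℝ (Fin d)) :
    τ.quadForm x ≤ ‖Matrix.toEuclideanCLM (n := Fin d) (𝕜 := ℝ) τ.A‖ * ‖x‖ ^ 2 := by
  refine (real_inner_le_norm _ _).trans ?_
  have := (Matrix.toEuclideanCLM (n := Fin d) (𝕜 := ℝ) τ.A).le_opNorm x
  nlinarith [norm_nonneg x]

/-- The operator norm of a symmetric matrix is controlled by its quadratic form. -/
lemma norm_toEuclideanCLM_le (τ : LevyTriplet d) {S : ℝ} (hS : 0 ≤ S)
    (h : ∀ x, ‖x‖ ≤ 1 → τ.quadForm x ≤ S) :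
    ‖Matrix.toEuclideanCLM (n := Fin d) (𝕜 := ℝ) τ.A‖ ≤ S := by
  refine ContinuousLinearMap.opNorm_le_of_re_inner_le (𝕜 := ℝ) hS fun x y hx hy => ?_
  set T := Matrix.toEuclideanCLM (n := Fin d) (𝕜 := ℝ) τ.A with hT
  have hsymm : inner ℝ y (T x) = inner ℝ x (T y) := by
    rw [hT, Matrix.inner_toEuclideanCLM, Matrix.inner_toEuclideanCLM, Matrix.dotProduct_mulVec,
      dotProduct_comm, ← Matrix.mulVec_transpose]
    have : τ.A.transpose = τ.A := by
      simpa using τ.posSemidef_A.isHermitian.eq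
    rw [this]
  have h4 : 4 * inner ℝ (T x) y = τ.quadForm (x + y) - τ.quadForm (x - y) := by
    simp only [quadForm, map_add, map_sub, inner_add_left, inner_add_right, inner_sub_left,
      inner_sub_right, ← hT]
    rw [real_inner_comm y (T x), hsymm]
    ring
  have h5 : τ.quadForm (x + y) = 4 * τ.quadForm ((1 / 2 : ℝ) • (x + y)) := by
    rw [quadForm_smul]; ring
  have h6 := h ((1 / 2 : ℝ) • (x + y)) (by
    rw [norm_smul]
    have := norm_add_le x y
    norm_num
    linarith)
  have h7 := τ.quadForm_nonneg (x - y)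
  simp only [RCLike.re_to_real]
  linarith

lemma integral_one_sub_cos_nonneg (τ : LevyTriplet d) (x : EuclideanSpace ℝ (Fin d)) :
    0 ≤ ∫ z, (1 - Real.cos (inner ℝ x z)) ∂τ.N :=
  integral_nonneg fun z => by simpa using Real.cos_le_one (inner ℝ x z)

lemma reExponent_nonneg (τ : LevyTriplet d) (x : EuclideanSpace ℝ (Fin d)) :
    0 ≤ τ.reExponent x :=
  add_nonneg (τ.quadForm_nonneg x) (τ.integral_one_sub_cos_nonneg x)

lemma reExponent_nat_smul_le (τ : LevyTriplet d) (n : ℕ) (x : EuclideanSpace ℝ (Fin d)) :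
    τ.reExponent ((n : ℝ) • x) ≤ (n : ℝ) ^ 2 * τ.reExponent x := by
  rw [reExponent, reExponent, quadForm_smul, mul_add, ← integral_const_mul]
  refine add_le_add_right ?_ _
  refine integral_mono (τ.integrable_one_sub_cos_inner _)
    ((τ.integrable_one_sub_cos_inner x).const_mul _) fun z => ?_
  simpa only [real_inner_smul_left] using one_sub_cos_nat_mul_le n (inner ℝ x z)

lemma reExponent_add_le (τ : LevyTriplet d) (x y : EuclideanSpace ℝ (Fin d)) :
    τ.reExponent (x + y) ≤ 2 * τ.reExponent x + 2 * τ.reExponent y := by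
  have h : ∫ z, (1 - Real.cos (inner ℝ (x + y) z)) ∂τ.N
      ≤ 2 * ∫ z, (1 - Real.cos (inner ℝ x z)) ∂τ.N
        + 2 * ∫ z, (1 - Real.cos (inner ℝ y z)) ∂τ.N := by
    rw [← integral_const_mul, ← integral_const_mul, ← integral_add
      ((τ.integrable_one_sub_cos_inner x).const_mul _)
      ((τ.integrable_one_sub_cos_inner y).const_mul _)]
    refine integral_mono (τ.integrable_one_sub_cos_inner _)
      (((τ.integrable_one_sub_cos_inner x).const_mul _).add
      ((τ.integrable_one_sub_cos_inner y).const_mul _)) fun z => ?_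
    simpa only [inner_add_left] using one_sub_cos_add_le (inner ℝ x z) (inner ℝ y z)
  have h' := τ.quadForm_add_le x y
  simp only [reExponent]
  linarith

/-! ### Truncated second moments in a direction -/

/-- The directional analogue of the concentration function,
`⟨x, A x⟩ + ∫ (1 ∧ ⟨x, z⟩²) N(dz)`. -/
noncomputable def truncExponent (τ : LevyTriplet d) (x : EuclideanSpace ℝ (Fin d)) : ℝ :=
  τ.quadForm x + ∫ z, min 1 ((inner ℝ x z : ℝ) ^ 2) ∂τ.N

/-- The contribution of the Gaussian part and of the small jumps in the direction `x`,
`⟨x, A x⟩ + ∫_{|⟨x, z⟩| < 1} ⟨x, z⟩² N(dz)`. -/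
noncomputable def localExponent (τ : LevyTriplet d) (x : EuclideanSpace ℝ (Fin d)) : ℝ :=
  τ.quadForm x + ∫ z in {z : EuclideanSpace ℝ (Fin d) | |(inner ℝ x z : ℝ)| < 1},
    |(inner ℝ x z : ℝ)| ^ 2 ∂τ.N

lemma measurableSet_abs_inner_lt (x : EuclideanSpace ℝ (Fin d)) :
    MeasurableSet {z : EuclideanSpace ℝ (Fin d) | |(inner ℝ x z : ℝ)| < 1} :=
  measurableSet_lt (by fun_prop) measurable_const

lemma integrable_indicator_inner_sq (τ : LevyTriplet d) (x : EuclideanSpace ℝ (Fin d)) :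
    Integrable ({z : EuclideanSpace ℝ (Fin d) | |(inner ℝ x z : ℝ)| < 1}.indicator
      fun z => |(inner ℝ x z : ℝ)| ^ 2) τ.N := by
  refine (τ.integrable_min_one_inner_sq x).mono'
    ((Continuous.aestronglyMeasurable (by fun_prop)).indicator (measurableSet_abs_inner_lt x))
    (ae_of_all _ fun z => ?_)
  by_cases hz : |(inner ℝ x z : ℝ)| < 1
  · rw [Set.indicator_of_mem (by exact hz), Real.norm_of_nonneg (by positivity), sq_abs]
    refine le_min ?_ le_rfl
    rw [← sq_abs]
    nlinarith [abs_nonneg (inner ℝ x z : ℝ)]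
  · rw [Set.indicator_of_notMem (by exact hz), norm_zero]
    positivity

lemma localExponent_eq (τ : LevyTriplet d) (x : EuclideanSpace ℝ (Fin d)) :
    τ.localExponent x = τ.quadForm x
      + ∫ z, {z : EuclideanSpace ℝ (Fin d) | |(inner ℝ x z : ℝ)| < 1}.indicator
        (fun z => |(inner ℝ x z : ℝ)| ^ 2) z ∂τ.N := by
  rw [localExponent, integral_indicator (measurableSet_abs_inner_lt x)]

lemma localExponent_nonneg (τ : LevyTriplet d) (x : EuclideanSpace ℝ (Fin d)) :
    0 ≤ τ.localExponent x :=
  add_nonneg (τ.quadForm_nonneg x) (integral_nonneg fun z => by positivity)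

lemma localExponent_le_five_mul_reExponent (τ : LevyTriplet d) (x : EuclideanSpace ℝ (Fin d)) :
    τ.localExponent x ≤ 5 * τ.reExponent x := by
  rw [localExponent_eq, reExponent, mul_add, ← integral_const_mul]
  have := τ.quadForm_nonneg x
  gcongr ?_ + ?_
  · linarith
  refine integral_mono (τ.integrable_indicator_inner_sq x)
    ((τ.integrable_one_sub_cos_inner x).const_mul 5) fun z => ?_
  refine Set.indicator_le' (s := {z : EuclideanSpace ℝ (Fin d) | |(inner ℝ x z : ℝ)| < 1})
    (f := fun z => |(inner ℝ x z : ℝ)| ^ 2) (g := fun z => 5 * (1 - Real.cos (inner ℝ x z)))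
    (fun z hz => ?_) (fun z hz => ?_) z
  · rw [sq_abs]
    exact sq_le_five_mul_one_sub_cos ((le_of_lt hz).trans (by linarith [Real.pi_gt_three]))
  · have hcos := Real.cos_le_one (inner ℝ x z)
    linarith

lemma reExponent_le_two_mul_truncExponent (τ : LevyTriplet d) (x : EuclideanSpace ℝ (Fin d)) :
    τ.reExponent x ≤ 2 * τ.truncExponent x := by
  rw [truncExponent, reExponent, mul_add, ← integral_const_mul]
  have := τ.quadForm_nonneg x
  gcongr ?_ + ?_
  · linarith
  exact integral_mono (τ.integrable_one_sub_cos_inner x)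
    ((τ.integrable_min_one_inner_sq x).const_mul 2) fun z => one_sub_cos_le_two_mul_min _

lemma h_inv_eq (τ : LevyTriplet d) (r : ℝ) :
    τ.h r⁻¹ = ‖Matrix.toEuclideanCLM (n := Fin d) (𝕜 := ℝ) τ.A‖ * r ^ 2
      + ∫ z, min 1 (r ^ 2 * ‖z‖ ^ 2) ∂τ.N := by
  simp only [h, inv_pow, div_inv_eq_mul, mul_comm (_ ^ 2) (r ^ 2)]

lemma truncExponent_le_h (τ : LevyTriplet d) {x : EuclideanSpace ℝ (Fin d)} {r : ℝ}
    (hx : ‖x‖ ≤ r) : τ.truncExponent x ≤ τ.h r⁻¹ := by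
  rw [h_inv_eq, truncExponent]
  have hsq : ‖x‖ ^ 2 ≤ r ^ 2 := by gcongr
  gcongr ?_ + ?_
  · exact (τ.quadForm_le x).trans (by gcongr)
  · refine integral_mono (τ.integrable_min_one_inner_sq x)
      (τ.integrable_min_one_mul_norm_sq (sq_nonneg r)) fun z => min_le_min_left _ ?_
    exact (inner_sq_le x z).trans (by gcongr)

lemma reExponent_le_h (τ : LevyTriplet d) {x : EuclideanSpace ℝ (Fin d)} {r : ℝ}
    (hx : ‖x‖ ≤ r) : τ.reExponent x ≤ 2 * τ.h r⁻¹ :=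
  (τ.reExponent_le_two_mul_truncExponent x).trans
    (mul_le_mul_of_nonneg_left (τ.truncExponent_le_h hx) zero_le_two)

/-! ### Comparison of `ψ*` with the concentration function -/

lemma charExponentStar_eq (τ : LevyTriplet d) (r : ℝ) :
    τ.charExponentStar r = sSup (τ.reExponent '' Metric.closedBall 0 r) := by
  simp only [charExponentStar, re_charExponent]

lemma reExponent_le_charExponentStar (τ : LevyTriplet d) {x : EuclideanSpace ℝ (Fin d)} {r : ℝ}
    (hx : ‖x‖ ≤ r) : τ.reExponent x ≤ τ.charExponentStar r := by
  rw [charExponentStar_eq]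
  refine le_csSup ⟨2 * τ.h r⁻¹, ?_⟩ ⟨x, by simpa using hx, rfl⟩
  rintro _ ⟨y, hy, rfl⟩
  exact τ.reExponent_le_h (by simpa using hy)

lemma charExponentStar_le (τ : LevyTriplet d) {r M : ℝ} (hr : 0 ≤ r)
    (h : ∀ x, ‖x‖ ≤ r → τ.reExponent x ≤ M) : τ.charExponentStar r ≤ M := by
  rw [charExponentStar_eq]
  refine csSup_le ((Metric.nonempty_closedBall.2 hr).image _) ?_
  rintro _ ⟨y, hy, rfl⟩
  exact h y (by simpa using hy)

lemma charExponentStar_nonneg (τ : LevyTriplet d) {r : ℝ} (hr : 0 ≤ r) :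
    0 ≤ τ.charExponentStar r :=
  (τ.reExponent_nonneg 0).trans (τ.reExponent_le_charExponentStar (by simpa using hr))

lemma charExponentStar_mono (τ : LevyTriplet d) {r s : ℝ} (hr : 0 ≤ r) (hrs : r ≤ s) :
    τ.charExponentStar r ≤ τ.charExponentStar s :=
  τ.charExponentStar_le hr fun _ hx => τ.reExponent_le_charExponentStar (hx.trans hrs)

lemma charExponentStar_le_h (τ : LevyTriplet d) {r : ℝ} (hr : 0 ≤ r) :
    τ.charExponentStar r ≤ 2 * τ.h r⁻¹ :=
  τ.charExponentStar_le hr fun _ hx => τ.reExponent_le_h hx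

/-- Averaging `Re ψ` over the segment from `0` to `x` recovers the truncated second moment of the
Lévy measure in the direction `x`. -/
lemma integral_min_one_inner_sq_le (τ : LevyTriplet d) {x : EuclideanSpace ℝ (Fin d)} {M : ℝ}
    (hM : ∀ s : ℝ, 0 ≤ s → s ≤ 1 → τ.reExponent (s • x) ≤ M) :
    ∫ z, min 1 ((inner ℝ x z : ℝ) ^ 2) ∂τ.N ≤ 15 * M := by
  have hM0 : 0 ≤ M := (τ.reExponent_nonneg _).trans (hM 0 le_rfl zero_le_one)
  rw [← ENNReal.ofReal_le_ofReal_iff (by positivity),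
    ofReal_integral_eq_lintegral_ofReal (τ.integrable_min_one_inner_sq x)
      (ae_of_all _ fun z => by positivity)]
  have hcos : ∀ u : ℝ, 0 ≤ 1 - Real.cos u := fun u => by linarith [Real.cos_le_one u]
  calc ∫⁻ z, ENNReal.ofReal (min 1 ((inner ℝ x z : ℝ) ^ 2)) ∂τ.N
      ≤ ∫⁻ z, ENNReal.ofReal 15 * (∫⁻ s in Set.Ioc (0 : ℝ) 1,
          ENNReal.ofReal (1 - Real.cos (s * inner ℝ x z))) ∂τ.N := by
        refine lintegral_mono fun z => ?_
        rw [← ofReal_integral_eq_lintegral_ofReal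
          (((Continuous.intervalIntegrable (by fun_prop) (0 : ℝ) 1).1))
          (ae_of_all _ fun s => hcos _), ← ENNReal.ofReal_mul (by norm_num),
          ← intervalIntegral.integral_of_le zero_le_one]
        exact ENNReal.ofReal_le_ofReal (min_one_sq_le_integral_one_sub_cos _)
    _ = ENNReal.ofReal 15 * ∫⁻ s in Set.Ioc (0 : ℝ) 1, (∫⁻ z,
          ENNReal.ofReal (1 - Real.cos (s * inner ℝ x z)) ∂τ.N) := by
        rw [lintegral_const_mul', lintegral_lintegral_swap]
        · exact (Continuous.measurable (f := fun p : EuclideanSpace ℝ (Fin d) × ℝ =>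
            1 - Real.cos (p.2 * inner ℝ x p.1)) (by fun_prop)).ennreal_ofReal.aemeasurable
        · exact ENNReal.ofReal_ne_top
    _ ≤ ENNReal.ofReal 15 * ∫⁻ s in Set.Ioc (0 : ℝ) 1, ENNReal.ofReal M := by
        gcongr ENNReal.ofReal 15 * ?_
        refine setLIntegral_mono measurable_const fun s hs => ?_
        simp only [← real_inner_smul_left]
        rw [← ofReal_integral_eq_lintegral_ofReal (τ.integrable_one_sub_cos_inner _)
          (ae_of_all _ fun z => hcos _)]
        refine ENNReal.ofReal_le_ofReal (le_trans ?_ (hM s hs.1.le hs.2))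
        exact le_add_of_nonneg_left (τ.quadForm_nonneg _)
    _ = ENNReal.ofReal (15 * M) := by
        rw [setLIntegral_const, Real.volume_Ioc, sub_zero, ENNReal.ofReal_one, mul_one,
          ENNReal.ofReal_mul (by norm_num)]

lemma min_one_sum_le {ι : Type*} (s : Finset ι) (a : ι → ℝ) (ha : ∀ i, 0 ≤ a i) :
    min 1 (∑ i ∈ s, a i) ≤ ∑ i ∈ s, min 1 (a i) := by
  classical
  induction s using Finset.induction_on with
  | empty => simp
  | insert i s hi ih =>
    rw [Finset.sum_insert hi, Finset.sum_insert hi]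
    have hs : 0 ≤ ∑ j ∈ s, a j := Finset.sum_nonneg fun j _ => ha j
    have := ha i
    grind

lemma h_le_charExponentStar (τ : LevyTriplet d) (hd : 1 ≤ d) {r : ℝ} (hr : 0 < r) :
    τ.h r⁻¹ ≤ 16 * d * τ.charExponentStar r := by
  have hS := τ.charExponentStar_nonneg hr.le
  have hA : ‖Matrix.toEuclideanCLM (n := Fin d) (𝕜 := ℝ) τ.A‖ * r ^ 2
      ≤ τ.charExponentStar r := by
    rw [← le_div_iff₀ (by positivity)]
    refine τ.norm_toEuclideanCLM_le (by positivity) fun x hx => ?_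
    rw [le_div_iff₀ (by positivity), mul_comm, ← quadForm_smul]
    refine (le_add_of_nonneg_right (τ.integral_one_sub_cos_nonneg _)).trans
      (τ.reExponent_le_charExponentStar (x := r • x) ?_)
    rw [norm_smul, Real.norm_of_nonneg hr.le]
    nlinarith
  have hN : ∫ z, min 1 (r ^ 2 * ‖z‖ ^ 2) ∂τ.N ≤ d * (15 * τ.charExponentStar r) := by
    have hle : ∫ z, min 1 (r ^ 2 * ‖z‖ ^ 2) ∂τ.N
        ≤ ∫ z, ∑ i : Fin d,
          min 1 ((inner ℝ (r • EuclideanSpace.single i (1 : ℝ)) z : ℝ) ^ 2) ∂τ.N := by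
      refine integral_mono (τ.integrable_min_one_mul_norm_sq (sq_nonneg r))
        (integrable_finsetSum _ fun i _ => τ.integrable_min_one_inner_sq _) fun z => ?_
      refine le_trans (le_of_eq ?_) (min_one_sum_le _ _ fun i => sq_nonneg _)
      congr 1
      rw [EuclideanSpace.norm_sq_eq, Finset.mul_sum]
      refine Finset.sum_congr rfl fun i _ => ?_
      rw [real_inner_smul_left, EuclideanSpace.inner_single_left, mul_pow]
      simp
    refine hle.trans ?_
    rw [integral_finsetSum _ fun i _ => τ.integrable_min_one_inner_sq _]
    refine (Finset.sum_le_card_nsmul _ _ (15 * τ.charExponentStar r) fun i _ =>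
      τ.integral_min_one_inner_sq_le fun s hs0 hs1 =>
        τ.reExponent_le_charExponentStar ?_).trans (by simp)
    rw [norm_smul, norm_smul, Real.norm_of_nonneg hs0, Real.norm_of_nonneg hr.le]
    simp only [PiLp.norm_single, norm_one, mul_one]
    nlinarith
  have hd' : (1 : ℝ) ≤ d := by exact_mod_cast hd
  rw [h_inv_eq]
  nlinarith

lemma truncExponent_le_charExponentStar (τ : LevyTriplet d) (hd : 1 ≤ d)
    {x : EuclideanSpace ℝ (Fin d)} {r : ℝ} (hr : 0 < r) (hx : ‖x‖ ≤ r) :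
    τ.truncExponent x ≤ 16 * d * τ.charExponentStar r :=
  (τ.truncExponent_le_h hx).trans (τ.h_le_charExponentStar hd hr)

/-! ### The inverse of the concentration function -/

lemma h_nonneg (τ : LevyTriplet d) (r : ℝ) : 0 ≤ τ.h r :=
  add_nonneg (by positivity) (integral_nonneg fun z => by positivity)

lemma integrable_min_one_div (τ : LevyTriplet d) (r : ℝ) :
    Integrable (fun z => min 1 (‖z‖ ^ 2 / r ^ 2)) τ.N := by
  simpa only [div_eq_inv_mul] using
    τ.integrable_min_one_mul_norm_sq (c := (r ^ 2)⁻¹) (by positivity)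

lemma h_antitoneOn (τ : LevyTriplet d) : AntitoneOn τ.h (Set.Ioi 0) := by
  intro r hr s hs hrs
  have hr' : (0 : ℝ) < r := hr
  have hsq : r ^ 2 ≤ s ^ 2 := by gcongr
  unfold h
  gcongr ?_ + ?_
  · gcongr
  · exact integral_mono (τ.integrable_min_one_div _) (τ.integrable_min_one_div _)
      fun z => min_le_min_left _ (by gcongr)

/-- In the variable `r⁻²` the concentration function is concave. -/
lemma h_concave (τ : LevyTriplet d) {r s t a b : ℝ} (ha : 0 ≤ a) (hb : 0 ≤ b)
    (hab : a + b = 1) (h : a * (r ^ 2)⁻¹ + b * (s ^ 2)⁻¹ = (t ^ 2)⁻¹) :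
    a * τ.h r + b * τ.h s ≤ τ.h t := by
  unfold LevyTriplet.h
  have hint : a * ∫ z, min 1 (‖z‖ ^ 2 / r ^ 2) ∂τ.N + b * ∫ z, min 1 (‖z‖ ^ 2 / s ^ 2) ∂τ.N
      ≤ ∫ z, min 1 (‖z‖ ^ 2 / t ^ 2) ∂τ.N := by
    rw [← integral_const_mul, ← integral_const_mul, ← integral_add
      ((τ.integrable_min_one_div _).const_mul _) ((τ.integrable_min_one_div _).const_mul _)]
    refine integral_mono (((τ.integrable_min_one_div _).const_mul _).add
      ((τ.integrable_min_one_div _).const_mul _)) (τ.integrable_min_one_div _) fun z => ?_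
    refine le_min ?_ ?_
    · nlinarith [min_le_left 1 (‖z‖ ^ 2 / r ^ 2), min_le_left 1 (‖z‖ ^ 2 / s ^ 2)]
    · have e : ‖z‖ ^ 2 / t ^ 2 = a * (‖z‖ ^ 2 / r ^ 2) + b * (‖z‖ ^ 2 / s ^ 2) := by
        rw [div_eq_mul_inv, ← h]; ring
      rw [e]
      gcongr <;> exact min_le_right _ _
  have e : ‖Matrix.toEuclideanCLM (n := Fin d) (𝕜 := ℝ) τ.A‖ / t ^ 2
      = a * (‖Matrix.toEuclideanCLM (n := Fin d) (𝕜 := ℝ) τ.A‖ / r ^ 2)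
        + b * (‖Matrix.toEuclideanCLM (n := Fin d) (𝕜 := ℝ) τ.A‖ / s ^ 2) := by
    rw [div_eq_mul_inv, ← h]; ring
  rw [e]
  linarith

/-- A concave function that is unbounded above is strictly monotone; so `h` is strictly
decreasing as soon as it is unbounded near `0`. -/
lemma h_strictAntiOn (τ : LevyTriplet d) (h_zero : Tendsto τ.h (𝓝[>] 0) atTop) :
    StrictAntiOn τ.h (Set.Ioi 0) := by
  intro r hr s hs hrs
  have hr' : (0 : ℝ) < r := hr
  have hs' : (0 : ℝ) < s := hs
  refine lt_of_le_of_ne (τ.h_antitoneOn hr hs hrs.le) fun heq => ?_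
  obtain ⟨q, hq1, hq2⟩ := ((h_zero.eventually_gt_atTop (τ.h r)).and
    (Ioo_mem_nhdsGT hr')).exists
  have hq0 : 0 < q := hq2.1
  have h1 : (s ^ 2)⁻¹ < (r ^ 2)⁻¹ := by gcongr
  have h2 : (r ^ 2)⁻¹ < (q ^ 2)⁻¹ := by
    have := hq2.2
    gcongr
  set u := (s ^ 2)⁻¹
  set v := (r ^ 2)⁻¹
  set w := (q ^ 2)⁻¹
  have hwu : 0 < w - u := by linarith
  have hb : 0 < (v - u) / (w - u) := div_pos (by linarith) hwu
  have ha : 0 ≤ (w - v) / (w - u) := div_nonneg (by linarith) hwu.le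
  have hab : (w - v) / (w - u) + (v - u) / (w - u) = 1 := by
    field_simp
    ring
  have := τ.h_concave (r := s) (s := q) (t := r) ha hb.le hab (by
    change (w - v) / (w - u) * u + (v - u) / (w - u) * w = v
    field_simp
    ring)
  rw [heq] at this
  have h3 : (w - v) / (w - u) * τ.h r = τ.h r - (v - u) / (w - u) * τ.h r := by
    rw [← eq_sub_iff_add_eq] at hab
    rw [hab]; ring
  nlinarith

lemma h_continuousOn (τ : LevyTriplet d) : ContinuousOn τ.h (Set.Ioi 0) := by
  intro r hr
  have hr' : (0 : ℝ) < r := hr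
  refine ContinuousAt.continuousWithinAt ?_
  refine ContinuousAt.add (continuousAt_const.div (by fun_prop) (by positivity)) ?_
  refine continuousAt_of_dominated
    (bound := fun z => min 1 (‖z‖ ^ 2 / (r / 2) ^ 2)) ?_ ?_ ?_ ?_
  · exact .of_forall fun s => (τ.integrable_min_one_div s).aestronglyMeasurable
  · filter_upwards [lt_mem_nhds (half_lt_self hr')] with s hs
    refine ae_of_all _ fun z => ?_
    rw [Real.norm_of_nonneg (by positivity)]
    exact min_le_min_left _ (by gcongr)
  · exact τ.integrable_min_one_div (r / 2)
  · refine ae_of_all _ fun z => ?_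
    exact continuousAt_const.min (continuousAt_const.div (by fun_prop) (by positivity))

lemma h_tendsto_atTop (τ : LevyTriplet d) : Tendsto τ.h atTop (𝓝 0) := by
  have hsq : Tendsto (fun r : ℝ => r ^ 2) atTop atTop := tendsto_pow_atTop two_ne_zero
  have h1 : Tendsto (fun r : ℝ => ‖Matrix.toEuclideanCLM (n := Fin d) (𝕜 := ℝ) τ.A‖ / r ^ 2)
      atTop (𝓝 0) := hsq.const_div_atTop _
  have h2 : Tendsto (fun r : ℝ => ∫ z, min 1 (‖z‖ ^ 2 / r ^ 2) ∂τ.N) atTop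
      (𝓝 (∫ _, (0 : ℝ) ∂τ.N)) := by
    refine tendsto_integral_filter_of_dominated_convergence (fun z => min 1 (‖z‖ ^ 2)) ?_ ?_
      τ.integrable_min_one_norm_sq ?_
    · exact .of_forall fun s => (τ.integrable_min_one_div s).aestronglyMeasurable
    · filter_upwards [eventually_ge_atTop 1] with r hr
      refine ae_of_all _ fun z => ?_
      rw [Real.norm_of_nonneg (by positivity)]
      exact min_le_min_left _ (div_le_self (by positivity) (one_le_pow₀ hr))
    · refine ae_of_all _ fun z => ?_
      simpa using (tendsto_const_nhds (x := (1 : ℝ))).min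
        (hsq.const_div_atTop (‖z‖ ^ 2))
  have h3 := h1.add h2
  rwa [integral_zero, add_zero] at h3

lemma h_pos (τ : LevyTriplet d) (h_zero : Tendsto τ.h (𝓝[>] 0) atTop) {r : ℝ} (hr : 0 < r) :
    0 < τ.h r :=
  (τ.h_nonneg (r + 1)).trans_lt
    (τ.h_strictAntiOn h_zero hr (by simp; linarith : (r + 1) ∈ Set.Ioi 0) (by linarith))

lemma exists_h_eq (τ : LevyTriplet d) (h_zero : Tendsto τ.h (𝓝[>] 0) atTop) {u : ℝ}
    (hu : 0 < u) : ∃ r ∈ Set.Ioi (0 : ℝ), τ.h r = u := by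
  obtain ⟨q, hq1, hq0⟩ := ((h_zero.eventually_gt_atTop u).and self_mem_nhdsWithin).exists
  obtain ⟨s, hs1, hs0⟩ := ((τ.h_tendsto_atTop.eventually_lt_const hu).and
    (eventually_gt_atTop 0)).exists
  obtain ⟨r, hr, hru⟩ := (isPreconnected_Ioi (a := (0 : ℝ))).intermediate_value
    (show s ∈ Set.Ioi 0 from hs0) hq0 τ.h_continuousOn ⟨hs1.le, hq1.le⟩
  exact ⟨r, hr, hru⟩

lemma hInv_pos (τ : LevyTriplet d) (h_zero : Tendsto τ.h (𝓝[>] 0) atTop) {u : ℝ}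
    (hu : 0 < u) : 0 < τ.hInv u :=
  Function.invFunOn_mem (τ.exists_h_eq h_zero hu)

lemma h_hInv (τ : LevyTriplet d) (h_zero : Tendsto τ.h (𝓝[>] 0) atTop) {u : ℝ}
    (hu : 0 < u) : τ.h (τ.hInv u) = u :=
  Function.invFunOn_eq (τ.exists_h_eq h_zero hu)

lemma hInv_h (τ : LevyTriplet d) (h_zero : Tendsto τ.h (𝓝[>] 0) atTop) {r : ℝ}
    (hr : 0 < r) : τ.hInv (τ.h r) = r :=
  (τ.h_strictAntiOn h_zero).injOn (τ.hInv_pos h_zero (τ.h_pos h_zero hr)) hr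
    (τ.h_hInv h_zero (τ.h_pos h_zero hr))

lemma le_hInv_iff (τ : LevyTriplet d) (h_zero : Tendsto τ.h (𝓝[>] 0) atTop) {r u : ℝ}
    (hr : 0 < r) (hu : 0 < u) : r ≤ τ.hInv u ↔ u ≤ τ.h r := by
  conv_rhs => rw [← τ.h_hInv h_zero hu]
  exact ((τ.h_strictAntiOn h_zero).le_iff_ge (τ.hInv_pos h_zero hu) hr).symm

end LevyTriplet

/-! ### The volume of Euclidean balls -/

/-- The volume of the Euclidean unit ball. -/
noncomputable def unitBallVolume (d : ℕ) : ℝ :=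
  (volume (Metric.ball (0 : EuclideanSpace ℝ (Fin d)) 1)).toReal

lemma unitBallVolume_pos (d : ℕ) : 0 < unitBallVolume d :=
  ENNReal.toReal_pos (Metric.measure_ball_pos _ _ one_pos).ne' measure_ball_lt_top.ne

lemma volume_ball_eq {d : ℕ} (x : EuclideanSpace ℝ (Fin d)) {r : ℝ} (hr : 0 < r) :
    volume (Metric.ball x r) = ENNReal.ofReal (r ^ d * unitBallVolume d) := by
  rw [Measure.addHaar_ball_of_pos _ _ hr, finrank_euclideanSpace_fin,
    ENNReal.ofReal_mul (by positivity), unitBallVolume,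
    ENNReal.ofReal_toReal measure_ball_lt_top.ne]

namespace LevyTriplet

variable {d : ℕ}

/-! ### Lower bounds for the integral of `exp (-t Re ψ)` -/

/-- The integral `∫ exp (-t Re ψ(z)) dz`, as an extended non-negative number. -/
noncomputable def expIntegral (τ : LevyTriplet d) (t : ℝ) : ℝ≥0∞ :=
  ∫⁻ z, ENNReal.ofReal (Real.exp (-t * τ.reExponent z))

lemma ofReal_exp_mul_volume_le_expIntegral (τ : LevyTriplet d) {t m : ℝ}
    {s : Set (EuclideanSpace ℝ (Fin d))} (hs : MeasurableSet s)
    (h : ∀ z ∈ s, t * τ.reExponent z ≤ m) :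
    ENNReal.ofReal (Real.exp (-m)) * volume s ≤ τ.expIntegral t := by
  rw [← setLIntegral_const]
  refine (setLIntegral_mono' hs fun z hz => ?_).trans (setLIntegral_le_lintegral s _)
  have := h z hz
  exact ENNReal.ofReal_le_ofReal (Real.exp_le_exp.2 (by linarith))

lemma ofReal_exp_mul_inv_pow_le_expIntegral (τ : LevyTriplet d) {r t : ℝ} (hr : 0 < r)
    (ht : 0 ≤ t) :
    ENNReal.ofReal (Real.exp (-(2 * t * τ.h r)) * ((r ^ d)⁻¹ * unitBallVolume d))
      ≤ τ.expIntegral t := by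
  rw [ENNReal.ofReal_mul (Real.exp_pos _).le, ← inv_pow,
    ← volume_ball_eq 0 (inv_pos.2 hr)]
  refine τ.ofReal_exp_mul_volume_le_expIntegral measurableSet_ball fun z hz => ?_
  have := τ.reExponent_le_h (x := z) (r := r⁻¹) (by simpa using (mem_ball_zero_iff.1 hz).le)
  rw [inv_inv] at this
  nlinarith

/-- If `Re ψ(x)` is small, then `Re ψ` stays bounded on many disjoint balls centred at the
multiples of `x`, because `Re ψ(k x) ≤ k² Re ψ(x)`. -/
lemma nat_mul_volume_le_expIntegral (τ : LevyTriplet d) {x : EuclideanSpace ℝ (Fin d)}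
    {ρ B t : ℝ} (hρx : ρ ≤ ‖x‖) (ht : 0 ≤ t)
    (hB : ∀ y, ‖y‖ ≤ ρ → τ.reExponent y ≤ B) (n : ℕ) :
    ENNReal.ofReal (Real.exp (-(2 * ((n : ℝ) ^ 2 * (t * τ.reExponent x) + t * B))))
      * (n * volume (Metric.ball (0 : EuclideanSpace ℝ (Fin d)) (ρ / 2)))
      ≤ τ.expIntegral t := by
  have hvol : volume (⋃ k ∈ Finset.range n, Metric.ball ((k : ℝ) • x) (ρ / 2))
      = n * volume (Metric.ball (0 : EuclideanSpace ℝ (Fin d)) (ρ / 2)) := by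
    rw [measure_biUnion_finset _ fun _ _ => measurableSet_ball]
    · simp only [Measure.addHaar_ball_center, Finset.sum_const, Finset.card_range, nsmul_eq_mul]
    · intro j _ k _ hjk
      refine Metric.ball_disjoint_ball ?_
      rw [dist_eq_norm, ← sub_smul, norm_smul, add_halves]
      have h1 : (1 : ℝ) ≤ ‖(j : ℝ) - k‖ := by
        have h2 : (1 : ℤ) ≤ |(j : ℤ) - k| :=
          Int.one_le_abs (sub_ne_zero.2 (by exact_mod_cast hjk))
        rw [Real.norm_eq_abs]
        exact_mod_cast h2
      nlinarith [norm_nonneg x]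
  rw [← hvol]
  refine τ.ofReal_exp_mul_volume_le_expIntegral
    (Finset.measurableSet_biUnion _ fun _ _ => measurableSet_ball) fun z hz => ?_
  simp only [Set.mem_iUnion, Finset.mem_range] at hz
  obtain ⟨k, hk, hzk⟩ := hz
  rw [mem_ball_iff_norm] at hzk
  have h1 := τ.reExponent_add_le ((k : ℝ) • x) (z - (k : ℝ) • x)
  rw [add_sub_cancel] at h1
  have h2 := hB (z - (k : ℝ) • x) (by linarith [norm_nonneg (z - (k : ℝ) • x)])
  have h3 := τ.reExponent_nat_smul_le k x
  have h4 : (k : ℝ) ^ 2 * τ.reExponent x ≤ (n : ℝ) ^ 2 * τ.reExponent x := by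
    have := τ.reExponent_nonneg x
    gcongr
  have h5 : τ.reExponent z ≤ 2 * ((n : ℝ) ^ 2 * τ.reExponent x + B) := by linarith
  nlinarith

/-- An upper bound for `∫ exp (-t Re ψ)` forces a lower bound for `Re ψ(x)`. -/
lemma one_lt_mul_reExponent (τ : LevyTriplet d) {x : EuclideanSpace ℝ (Fin d)}
    {ρ B t β K : ℝ} (hρ : 0 < ρ) (hρx : ρ ≤ ‖x‖) (ht : 0 ≤ t)
    (hB : ∀ y, ‖y‖ ≤ ρ → τ.reExponent y ≤ B) (hβ : t * B ≤ β)
    (hK : τ.expIntegral t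
      ≤ ENNReal.ofReal K * volume (Metric.ball (0 : EuclideanSpace ℝ (Fin d)) (ρ / 2)))
    {n : ℕ} (hn0 : 0 < n) (hn : K * Real.exp (2 + 2 * β) < n) :
    1 < (n : ℝ) ^ 2 * (t * τ.reExponent x) := by
  by_contra! hcon
  have h1 := (τ.nat_mul_volume_le_expIntegral hρx ht hB n).trans hK
  rw [← mul_assoc, ENNReal.mul_le_mul_iff_left
    (Metric.measure_ball_pos _ _ (half_pos hρ)).ne' measure_ball_lt_top.ne,
    ← ENNReal.ofReal_natCast n, ← ENNReal.ofReal_mul (Real.exp_pos _).le] at h1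
  have hn0' : (0 : ℝ) < n := by exact_mod_cast hn0
  have h2 := ENNReal.ofReal_le_ofReal_iff'.1 h1
  have h3 : Real.exp (-(2 * ((n : ℝ) ^ 2 * (t * τ.reExponent x) + t * B))) * n ≤ K :=
    h2.resolve_right (not_le.2 (by positivity))
  have h4 : Real.exp (-(2 + 2 * β))
      ≤ Real.exp (-(2 * ((n : ℝ) ^ 2 * (t * τ.reExponent x) + t * B))) :=
    Real.exp_le_exp.2 (by linarith)
  have h5 : Real.exp (-(2 + 2 * β)) * n ≤ K :=
    (mul_le_mul_of_nonneg_right h4 hn0'.le).trans h3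
  rw [Real.exp_neg, inv_mul_le_iff₀ (Real.exp_pos _)] at h5
  linarith

/-! ### Scaling -/

lemma lt_one_div_h (τ : LevyTriplet d) (h_zero : Tendsto τ.h (𝓝[>] 0) atTop) {r T : ℝ} (hT : 0 < T)
    (hr : τ.hInv (1 / T) < r) : 0 < r ∧ T < 1 / τ.h r := by
  have hr0 : 0 < r := (τ.hInv_pos h_zero (one_div_pos.2 hT)).trans hr
  refine ⟨hr0, ?_⟩
  have := mt (τ.le_hInv_iff h_zero hr0 (one_div_pos.2 hT)).2 (not_le.2 hr)
  exact (lt_one_div hT (τ.h_pos h_zero hr0)).2 (not_le.1 this)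

/-- A bound `∫ exp (-a t Re ψ) ≤ C h⁻¹(1/t)⁻ᵈ` forces `h` to grow by any prescribed factor `k` when
its argument is shrunk by a suitable fixed factor `c`: the integral over the ball of radius
`1 / h⁻¹(k/t)` must be of order at most `h⁻¹(1/t)⁻ᵈ`. -/
lemma exists_mul_h_le (τ : LevyTriplet d) (hd : 1 ≤ d)
    (h_zero : Tendsto τ.h (𝓝[>] 0) atTop) {a T C k : ℝ} (ha : 0 < a) (hT : 0 < T) (hC : 0 < C)
    (hk : 0 < k) (hbound : ∀ t, T < t →
      τ.expIntegral (a * t) ≤ ENNReal.ofReal (C * (τ.hInv (1 / t)) ^ (-(d : ℤ)))) :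
    ∃ c ∈ Set.Ioo (0 : ℝ) 1, ∀ r, τ.hInv (1 / T) < r → k * τ.h r ≤ τ.h (c * r) := by
  set q := Real.exp (-(2 * a * k)) * unitBallVolume d / C with hq
  have hω := unitBallVolume_pos d
  have hq0 : 0 < q := by positivity
  have hc0 : 0 < min (1 / 2) q := lt_min (by norm_num) hq0
  have hc1 : min (1 / 2) q < 1 := (min_le_left _ _).trans_lt (by norm_num)
  refine ⟨min (1 / 2) q, ⟨hc0, hc1⟩, fun r hr => ?_⟩
  obtain ⟨hr0, ht⟩ := τ.lt_one_div_h h_zero hT hr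
  have hh := τ.h_pos h_zero hr0
  have hkh : 0 < k * τ.h r := by positivity
  set s := τ.hInv (k * τ.h r) with hs
  have hs0 : 0 < s := τ.hInv_pos h_zero hkh
  have h1 := (τ.ofReal_exp_mul_inv_pow_le_expIntegral hs0
    (t := a * (1 / τ.h r)) (by positivity)).trans (hbound _ ht)
  rw [one_div_one_div, τ.hInv_h h_zero hr0, hs, τ.h_hInv h_zero hkh, ← hs,
    ENNReal.ofReal_le_ofReal_iff (by positivity), zpow_neg, zpow_natCast,
    show 2 * (a * (1 / τ.h r)) * (k * τ.h r) = 2 * a * k by field_simp] at h1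
  have h2 : q * r ^ d ≤ s ^ d := by
    rw [hq, div_mul_eq_mul_div, div_le_iff₀ hC]
    have h3 : Real.exp (-(2 * a * k)) * ((s ^ d)⁻¹ * unitBallVolume d) * (s ^ d * r ^ d)
        ≤ C * (r ^ d)⁻¹ * (s ^ d * r ^ d) := by gcongr
    have e1 : Real.exp (-(2 * a * k)) * ((s ^ d)⁻¹ * unitBallVolume d) * (s ^ d * r ^ d)
        = Real.exp (-(2 * a * k)) * unitBallVolume d * r ^ d := by field_simp
    have e2 : C * (r ^ d)⁻¹ * (s ^ d * r ^ d) = s ^ d * C := by field_simp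
    rwa [e1, e2] at h3
  have h4 : min (1 / 2) q * r ≤ s := by
    refine le_of_pow_le_pow_left₀ (by omega : d ≠ 0) hs0.le ?_
    rw [mul_pow]
    refine le_trans ?_ h2
    gcongr
    exact (pow_le_of_le_one hc0.le hc1.le (by omega)).trans (min_le_right _ _)
  rw [← τ.le_hInv_iff h_zero (by positivity) hkh]
  exact h4

/-- Iterating a halving inequality gives a power-type scaling condition. -/
lemma exists_scaling_of_halving {g : ℝ → ℝ} {c R : ℝ}
    (hg0 : ∀ r, 0 ≤ r → 0 ≤ g r) (hmono : ∀ r s, 0 ≤ r → r ≤ s → g r ≤ g s)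
    (hc : c ∈ Set.Ioo (0 : ℝ) 1) (h : ∀ r, 0 < r → r < R → g (c * r) ≤ g r / 2) :
    ∃ α ∈ Set.Ioc (0 : ℝ) 2, ∀ l r : ℝ, 0 < l → l ≤ 1 → 0 < r → r < R →
      g (l * r) ≤ 2 * l ^ α * g r := by
  obtain ⟨hc0, hc1⟩ := hc
  have hlog : 0 < -Real.log c := by linarith [Real.log_neg hc0 hc1]
  set α := min 2 (Real.log 2 / -Real.log c) with hα
  have hα0 : 0 < α := lt_min two_pos (div_pos (Real.log_pos one_lt_two) hlog)
  -- The exponent is chosen so that `c ^ α ≥ 1 / 2`.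
  have hcα : 1 / 2 ≤ c ^ α := by
    rw [Real.rpow_def_of_pos hc0, one_div, ← Real.exp_log (two_pos : (0 : ℝ) < 2),
      ← Real.exp_neg, Real.exp_le_exp]
    have h1 : α ≤ Real.log 2 / -Real.log c := min_le_right _ _
    rw [le_div_iff₀ hlog] at h1
    linarith
  have hiter : ∀ n : ℕ, ∀ r, 0 < r → r < R → g (c ^ n * r) ≤ (1 / 2) ^ n * g r := by
    intro n r hr hrR
    induction n with
    | zero => simp
    | succ n ih =>
      have hp : c ^ n ≤ 1 := pow_le_one₀ hc0.le hc1.le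
      have h1 := h (c ^ n * r) (by positivity) (by nlinarith)
      rw [pow_succ', mul_assoc, pow_succ]
      linarith
  refine ⟨α, ⟨hα0, min_le_left _ _⟩, fun l r hl0 hl1 hr hrR => ?_⟩
  obtain ⟨n, hn1, hn2⟩ := exists_nat_pow_near_of_lt_one hl0 hl1 hc0 hc1
  have h1 : g (l * r) ≤ (1 / 2) ^ n * g r :=
    (hmono _ _ (by positivity) (by gcongr)).trans (hiter n r hr hrR)
  have h2 : (1 / 2 : ℝ) ^ n ≤ 2 * l ^ α := by
    have h3 : (c ^ α) ^ (n + 1) ≤ l ^ α := by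
      rw [← Real.rpow_natCast, ← Real.rpow_mul hc0.le, mul_comm, Real.rpow_mul hc0.le,
        Real.rpow_natCast]
      exact Real.rpow_le_rpow (by positivity) hn1.le hα0.le
    have h4 : (1 / 2 : ℝ) ^ (n + 1) ≤ (c ^ α) ^ (n + 1) := by gcongr
    rw [pow_succ] at h4
    linarith
  exact h1.trans (mul_le_mul_of_nonneg_right h2 (hg0 r hr.le))

lemma exists_star_scaling_of_halving (τ : LevyTriplet d) {c R : ℝ}
    (hc : c ∈ Set.Ioo (0 : ℝ) 1)
    (h : ∀ r, 0 < r → r < R → τ.charExponentStar (c * r) ≤ τ.charExponentStar r / 2) :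
    ∃ α ∈ Set.Ioc (0 : ℝ) 2, ∀ l r : ℝ, 0 < l → l ≤ 1 → 0 < r → r < R →
      τ.charExponentStar (l * r) ≤ 2 * l ^ α * τ.charExponentStar r :=
  exists_scaling_of_halving (fun _ => τ.charExponentStar_nonneg)
    (fun _ _ => τ.charExponentStar_mono) hc h

lemma reExponent_zero (τ : LevyTriplet d) : τ.reExponent 0 = 0 := by
  simp [reExponent, quadForm]

lemma charExponentStar_zero (τ : LevyTriplet d) : τ.charExponentStar 0 = 0 := by
  refine le_antisymm (τ.charExponentStar_le le_rfl fun x hx => ?_)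
    (τ.charExponentStar_nonneg le_rfl)
  rw [norm_le_zero_iff.1 hx, reExponent_zero]

/-! ### From the integral bound to the scaling conditions -/

lemma exists_mul_star_le_reExponent_of_expIntegral_le (τ : LevyTriplet d)
    (h_zero : Tendsto τ.h (𝓝[>] 0) atTop) {T C : ℝ} (hT : 0 < T) (hC : 0 < C)
    (hbound : ∀ t, T < t →
      τ.expIntegral t ≤ ENNReal.ofReal (C * (τ.hInv (1 / t)) ^ (-(d : ℤ)))) :
    ∃ c ∈ Set.Ioc (0 : ℝ) 1, ∀ x : EuclideanSpace ℝ (Fin d), ‖x‖ < 1 / τ.hInv (1 / T) →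
      c * τ.charExponentStar ‖x‖ ≤ τ.reExponent x := by
  have hω := unitBallVolume_pos d
  set K := C * 2 ^ d / unitBallVolume d with hK
  obtain ⟨n, hn⟩ := exists_nat_gt (K * Real.exp (2 + 2 * 2))
  have hn0' : (0 : ℝ) < n := lt_trans (by positivity) hn
  have hn0 : 0 < n := by exact_mod_cast hn0'
  have hn1 : (1 : ℝ) ≤ n := by exact_mod_cast hn0
  refine ⟨1 / (2 * (n : ℝ) ^ 2), ⟨by positivity, ?_⟩, fun x hx => ?_⟩
  · rw [div_le_one (by positivity)]
    nlinarith
  rcases (norm_nonneg x).eq_or_lt with hx0 | hx0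
  · rw [← hx0, charExponentStar_zero, mul_zero]
    exact τ.reExponent_nonneg x
  have hR := τ.hInv_pos h_zero (one_div_pos.2 hT)
  obtain ⟨hr0, ht⟩ := τ.lt_one_div_h h_zero hT (r := ‖x‖⁻¹) (by
    rw [lt_inv_comm₀ hR hx0, inv_eq_one_div]; exact hx)
  have hh := τ.h_pos h_zero hr0
  have h1 := τ.one_lt_mul_reExponent (x := x) (ρ := ‖x‖) (B := 2 * τ.h ‖x‖⁻¹)
    (t := 1 / τ.h ‖x‖⁻¹) (β := 2) (K := K) hx0 le_rfl (by positivity)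
    (fun y hy => τ.reExponent_le_h hy)
    (by rw [one_div, mul_comm, mul_assoc, mul_inv_cancel₀ hh.ne', mul_one]) (by
      refine (hbound _ ht).trans (le_of_eq ?_)
      rw [one_div_one_div, τ.hInv_h h_zero hr0, volume_ball_eq _ (half_pos hx0),
        ← ENNReal.ofReal_mul (by positivity), hK, zpow_neg, zpow_natCast, inv_pow, inv_inv,
        div_pow]
      congr 1
      field_simp) hn0 hn
  have h2 := τ.charExponentStar_le_h hx0.le
  rw [one_div_mul_eq_div, ← mul_div_assoc, lt_div_iff₀ hh, one_mul] at h1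
  rw [one_div, inv_mul_le_iff₀ (by positivity)]
  linarith

lemma exists_scaling_of_expIntegral_le (τ : LevyTriplet d) (hd : 1 ≤ d)
    (h_zero : Tendsto τ.h (𝓝[>] 0) atTop) {T C : ℝ} (hT : 0 < T) (hC : 0 < C)
    (hbound : ∀ t, T < t →
      τ.expIntegral t ≤ ENNReal.ofReal (C * (τ.hInv (1 / t)) ^ (-(d : ℤ)))) :
    ∃ α ∈ Set.Ioc (0 : ℝ) 2, ∀ l r : ℝ, 0 < l → l ≤ 1 → 0 < r → r < 1 / τ.hInv (1 / T) →
      τ.charExponentStar (l * r) ≤ 2 * l ^ α * τ.charExponentStar r := by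
  have hd0 : (0 : ℝ) < d := by exact_mod_cast hd
  obtain ⟨c, hc, hch⟩ := τ.exists_mul_h_le hd h_zero (k := 64 * d) one_pos hT hC
    (by positivity) (by simpa only [one_mul] using hbound)
  refine τ.exists_star_scaling_of_halving hc fun r hr hrR => ?_
  have hR := τ.hInv_pos h_zero (one_div_pos.2 hT)
  have hcr : 0 < c * r := mul_pos hc.1 hr
  have h1 := hch (c * r)⁻¹ (by
    rw [lt_inv_comm₀ hR hcr, inv_eq_one_div]
    nlinarith [hc.2])
  rw [mul_inv, mul_inv_cancel_left₀ hc.1.ne', ← mul_inv] at h1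
  have h2 := τ.charExponentStar_le_h hcr.le
  have h3 := τ.h_le_charExponentStar hd hr
  have h4 : 64 * d * τ.h (c * r)⁻¹ ≤ d * (16 * τ.charExponentStar r) := by linarith
  have h5 : 64 * τ.h (c * r)⁻¹ ≤ 16 * τ.charExponentStar r :=
    le_of_mul_le_mul_left (by linarith) hd0
  linarith

/-! ### Equivalence of the scaling conditions and the bound by small jumps -/

lemma truncExponent_smul_le (τ : LevyTriplet d) (s : ℝ) (x : EuclideanSpace ℝ (Fin d)) :
    τ.truncExponent (s • x) ≤ τ.truncExponent x + s ^ 2 * τ.localExponent x := by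
  have hint : ∫ z, min 1 ((inner ℝ (s • x) z : ℝ) ^ 2) ∂τ.N
      ≤ ∫ z, min 1 ((inner ℝ x z : ℝ) ^ 2) ∂τ.N
        + s ^ 2 * ∫ z, {z : EuclideanSpace ℝ (Fin d) | |(inner ℝ x z : ℝ)| < 1}.indicator
          (fun z => |(inner ℝ x z : ℝ)| ^ 2) z ∂τ.N := by
    rw [← integral_const_mul, ← integral_add (τ.integrable_min_one_inner_sq x)
      ((τ.integrable_indicator_inner_sq x).const_mul _)]
    refine integral_mono (τ.integrable_min_one_inner_sq _)
      ((τ.integrable_min_one_inner_sq x).add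
      ((τ.integrable_indicator_inner_sq x).const_mul _)) fun z => ?_
    rw [real_inner_smul_left, mul_pow]
    by_cases hz : |(inner ℝ x z : ℝ)| < 1
    · rw [Set.indicator_of_mem (by exact hz), sq_abs]
      exact (min_le_right _ _).trans (le_add_of_nonneg_left (by positivity))
    · rw [Set.indicator_of_notMem (by exact hz), mul_zero, add_zero]
      have : 1 ≤ (inner ℝ x z : ℝ) ^ 2 := by
        rw [← sq_abs]; nlinarith [not_lt.1 hz]
      rw [min_eq_left this]
      exact min_le_left _ _
  rw [localExponent_eq, truncExponent, truncExponent, quadForm_smul, mul_add]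
  linarith [τ.quadForm_nonneg x]

/-- The small-jump part is dominated by a dyadic increment of the truncated second moment. -/
lemma localExponent_add_le (τ : LevyTriplet d) (x : EuclideanSpace ℝ (Fin d)) :
    τ.localExponent x + 4 / 3 * τ.truncExponent ((1 / 2 : ℝ) • x)
      ≤ 4 / 3 * τ.truncExponent x := by
  have hint : ∫ z, {z : EuclideanSpace ℝ (Fin d) | |(inner ℝ x z : ℝ)| < 1}.indicator
          (fun z => |(inner ℝ x z : ℝ)| ^ 2) z ∂τ.N
        + 4 / 3 * ∫ z, min 1 ((inner ℝ ((1 / 2 : ℝ) • x) z : ℝ) ^ 2) ∂τ.N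
      ≤ 4 / 3 * ∫ z, min 1 ((inner ℝ x z : ℝ) ^ 2) ∂τ.N := by
    rw [← integral_const_mul, ← integral_const_mul,
      ← integral_add (τ.integrable_indicator_inner_sq x)
        ((τ.integrable_min_one_inner_sq _).const_mul _)]
    refine integral_mono ((τ.integrable_indicator_inner_sq x).add
      ((τ.integrable_min_one_inner_sq _).const_mul _))
      ((τ.integrable_min_one_inner_sq _).const_mul _) fun z => ?_
    rw [real_inner_smul_left, mul_pow]
    by_cases hz : |(inner ℝ x z : ℝ)| < 1
    · rw [Set.indicator_of_mem (by exact hz), sq_abs]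
      have : (inner ℝ x z : ℝ) ^ 2 ≤ 1 := by
        rw [← sq_abs]; nlinarith [abs_nonneg (inner ℝ x z : ℝ)]
      rw [min_eq_right this]
      linarith [min_le_right 1 ((1 / 2 : ℝ) ^ 2 * (inner ℝ x z : ℝ) ^ 2)]
    · rw [Set.indicator_of_notMem (by exact hz), zero_add]
      have : 1 ≤ (inner ℝ x z : ℝ) ^ 2 := by
        rw [← sq_abs]; nlinarith [not_lt.1 hz]
      rw [min_eq_left this]
      linarith [min_le_left 1 ((1 / 2 : ℝ) ^ 2 * (inner ℝ x z : ℝ) ^ 2)]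
  rw [localExponent_eq, truncExponent, truncExponent, quadForm_smul]
  linarith

lemma sum_localExponent_le (τ : LevyTriplet d) (n : ℕ) (x : EuclideanSpace ℝ (Fin d)) :
    ∑ k ∈ Finset.range n, τ.localExponent ((1 / 2 : ℝ) ^ k • x) ≤ 4 / 3 * τ.truncExponent x := by
  have h : ∑ k ∈ Finset.range n, τ.localExponent ((1 / 2 : ℝ) ^ k • x)
      + 4 / 3 * τ.truncExponent ((1 / 2 : ℝ) ^ n • x) ≤ 4 / 3 * τ.truncExponent x := by
    induction n with
    | zero => simp
    | succ n ih =>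
      rw [Finset.sum_range_succ, pow_succ', mul_smul]
      linarith [τ.localExponent_add_le ((1 / 2 : ℝ) ^ n • x)]
  have h0 : 0 ≤ τ.truncExponent ((1 / 2 : ℝ) ^ n • x) :=
    add_nonneg (τ.quadForm_nonneg _) (integral_nonneg fun z => by positivity)
  linarith

lemma exists_scaling_of_star_le_localExponent (τ : LevyTriplet d) (hd : 1 ≤ d) {R C : ℝ}
    (hC : 0 ≤ C) (h : ∀ x : EuclideanSpace ℝ (Fin d), ‖x‖ < R →
      τ.charExponentStar ‖x‖ ≤ C * τ.localExponent x) :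
    ∃ α ∈ Set.Ioc (0 : ℝ) 2, ∀ l r : ℝ, 0 < l → l ≤ 1 → 0 < r → r < R →
      τ.charExponentStar (l * r) ≤ 2 * l ^ α * τ.charExponentStar r := by
  obtain ⟨n, hn⟩ := exists_nat_gt (2 * (C * (4 / 3 * (16 * d))))
  have hn0 : (0 : ℝ) < n := lt_of_le_of_lt (by positivity) hn
  have hn0' : n ≠ 0 := by
    rintro rfl
    simp at hn0
  refine τ.exists_star_scaling_of_halving (c := (1 / 2) ^ n)
    ⟨by positivity, pow_lt_one₀ (by norm_num) (by norm_num) hn0'⟩ fun r hr hrR => ?_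
  set e : EuclideanSpace ℝ (Fin d) := r • EuclideanSpace.single ⟨0, hd⟩ (1 : ℝ) with he
  have hnorm : ‖e‖ = r := by
    rw [he, norm_smul, Real.norm_of_nonneg hr.le, PiLp.norm_single, norm_one, mul_one]
  have h1 : n * τ.charExponentStar ((1 / 2) ^ n * r)
      ≤ C * ∑ k ∈ Finset.range n, τ.localExponent ((1 / 2 : ℝ) ^ k • e) := by
    rw [Finset.mul_sum]
    refine le_trans (by simp) (Finset.card_nsmul_le_sum (Finset.range n) _
      (τ.charExponentStar ((1 / 2) ^ n * r)) fun k hk => ?_)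
    have hk' : (1 / 2 : ℝ) ^ n ≤ (1 / 2) ^ k :=
      pow_le_pow_of_le_one (by norm_num) (by norm_num) (Finset.mem_range.1 hk).le
    have hk1 : (1 / 2 : ℝ) ^ k ≤ 1 := pow_le_one₀ (by norm_num) (by norm_num)
    have hnk : ‖(1 / 2 : ℝ) ^ k • e‖ = (1 / 2) ^ k * r := by
      rw [norm_smul, hnorm, Real.norm_of_nonneg (by positivity)]
    have h2 := h ((1 / 2 : ℝ) ^ k • e) (by rw [hnk]; nlinarith)
    rw [hnk] at h2
    exact (τ.charExponentStar_mono (by positivity) (by gcongr)).trans h2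
  have h3 := τ.sum_localExponent_le n e
  have h4 := τ.truncExponent_le_charExponentStar hd hr hnorm.le
  have h5 := τ.charExponentStar_nonneg hr.le
  have h6 : n * τ.charExponentStar ((1 / 2) ^ n * r) ≤ n * (τ.charExponentStar r / 2) :=
    calc n * τ.charExponentStar ((1 / 2) ^ n * r)
        ≤ C * (4 / 3 * (16 * d * τ.charExponentStar r)) := by
          refine h1.trans (mul_le_mul_of_nonneg_left ?_ hC)
          linarith
      _ = 2 * (C * (4 / 3 * (16 * d))) * (τ.charExponentStar r / 2) := by ring
      _ ≤ n * (τ.charExponentStar r / 2) := by gcongr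
  exact le_of_mul_le_mul_left h6 hn0

/-- If `ψ*` satisfies a lower scaling condition, then for a suitable `s > 1` the truncated second
moment in the direction `s x` is at least twice that in the direction `x`; the jumps with
`|⟨x, z⟩| ≥ 1` contribute equally to both, so the small-jump part dominates. -/
lemma exists_star_le_localExponent (τ : LevyTriplet d) (hd : 1 ≤ d) {T c α : ℝ} (hT : 0 < T)
    (hc : c ∈ Set.Ioc (0 : ℝ) 1) (hα : 0 < α)
    (hlower : ∀ x : EuclideanSpace ℝ (Fin d), ‖x‖ < 1 / T →
      c * τ.charExponentStar ‖x‖ ≤ τ.reExponent x)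
    (hscale : ∀ l r : ℝ, 0 < l → l ≤ 1 → 0 < r → r < 1 / T →
      τ.charExponentStar (l * r) ≤ (1 / c) * l ^ α * τ.charExponentStar r) :
    ∃ T' > (0 : ℝ), ∃ C : ℝ, 1 ≤ C ∧ ∀ x : EuclideanSpace ℝ (Fin d), ‖x‖ < 1 / T' →
      τ.charExponentStar ‖x‖ ≤ C * τ.localExponent x := by
  obtain ⟨hc0, hc1⟩ := hc
  have hd' : (1 : ℝ) ≤ d := by exact_mod_cast hd
  set Q := 64 * d / c ^ 2 with hQ
  have hQ1 : 1 ≤ Q := by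
    rw [hQ, le_div_iff₀ (by positivity)]
    nlinarith
  set s := Q ^ (1 / α) with hs
  have hs1 : 1 ≤ s := Real.one_le_rpow hQ1 (by positivity)
  have hs0 : 0 < s := by linarith
  have hsα : s ^ α = Q := by
    rw [hs, ← Real.rpow_mul (by linarith), one_div_mul_cancel hα.ne', Real.rpow_one]
  refine ⟨s * T, by positivity, 2 / c * s ^ 2, ?_, fun x hx => ?_⟩
  · rw [div_mul_eq_mul_div, le_div_iff₀ hc0]
    nlinarith
  have hloc := τ.localExponent_nonneg x
  rcases (norm_nonneg x).eq_or_lt with hx0 | hx0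
  · rw [← hx0, charExponentStar_zero]
    positivity
  have hsx : s * ‖x‖ < 1 / T := by
    rw [lt_div_iff₀ (by positivity)] at hx ⊢
    linarith
  have hx1 : ‖x‖ < 1 / T := lt_of_le_of_lt (by nlinarith) hsx
  have hnorm : ‖s • x‖ = s * ‖x‖ := by rw [norm_smul, Real.norm_of_nonneg hs0.le]
  have hS := τ.charExponentStar_nonneg hx0.le
  have h1 := hlower (s • x) (by rwa [hnorm])
  rw [hnorm] at h1
  have h2 := hscale s⁻¹ (s * ‖x‖) (by positivity) (inv_le_one_of_one_le₀ hs1) (by positivity) hsx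
  rw [inv_mul_cancel_left₀ hs0.ne', Real.inv_rpow hs0.le, hsα] at h2
  have h3 := τ.reExponent_le_two_mul_truncExponent (s • x)
  have h4 := τ.truncExponent_le_charExponentStar hd hx0 le_rfl
  have h5 := τ.truncExponent_smul_le s x
  have h6 : 64 * d * τ.charExponentStar ‖x‖ ≤ c * τ.charExponentStar (s * ‖x‖) := by
    have e : 1 / c * Q⁻¹ * τ.charExponentStar (s * ‖x‖)
        = c * τ.charExponentStar (s * ‖x‖) / (64 * d) := by
      rw [hQ]; field_simp
    rw [e, le_div_iff₀ (by positivity)] at h2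
    linarith
  have h7 : τ.truncExponent x ≤ s ^ 2 * τ.localExponent x := by linarith
  have h8 := hlower x hx1
  have h9 := τ.reExponent_le_two_mul_truncExponent x
  rw [div_mul_eq_mul_div, div_mul_eq_mul_div, le_div_iff₀ hc0]
  linarith

/-! ### From the scaling conditions to the integral bound -/

lemma integrable_exp_neg_mul_norm_rpow (hd : 1 ≤ d) {m α : ℝ} (hm : 0 < m) (hα : 0 < α) :
    Integrable fun u : EuclideanSpace ℝ (Fin d) => Real.exp (-m * ‖u‖ ^ α) := by
  have : Nonempty (Fin d) := ⟨⟨0, hd⟩⟩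
  refine (integrable_fun_norm_addHaar volume (f := fun y : ℝ => Real.exp (-m * y ^ α))).2 ?_
  have h := integrableOn_rpow_mul_exp_neg_mul_rpow (p := α) (s := ((d - 1 : ℕ) : ℝ)) (b := m)
    (by have : (0 : ℝ) ≤ ((d - 1 : ℕ) : ℝ) := Nat.cast_nonneg _
        linarith) hα hm
  simpa only [finrank_euclideanSpace_fin, smul_eq_mul, Real.rpow_natCast] using h

lemma lintegral_exp_neg_mul_norm_rpow_smul (hd : 1 ≤ d) {m α r : ℝ} (hm : 0 < m) (hα : 0 < α)
    (hr : 0 < r) :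
    ∫⁻ z : EuclideanSpace ℝ (Fin d), ENNReal.ofReal (Real.exp (-m * ‖r • z‖ ^ α))
      = ENNReal.ofReal ((r ^ d)⁻¹
        * ∫ u : EuclideanSpace ℝ (Fin d), Real.exp (-m * ‖u‖ ^ α)) := by
  rw [← ofReal_integral_eq_lintegral_ofReal
    ((integrable_exp_neg_mul_norm_rpow hd hm hα).comp_smul hr.ne')
    (ae_of_all _ fun z => (Real.exp_pos _).le),
    Measure.integral_comp_smul_of_nonneg volume
      (fun u : EuclideanSpace ℝ (Fin d) => Real.exp (-m * ‖u‖ ^ α)) r (hR := hr.le),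
    finrank_euclideanSpace_fin, smul_eq_mul]

/-- Integrability of a single `exp (-t₀ Re ψ)` keeps `Re ψ` away from `0` outside any ball. -/
lemma exists_le_reExponent_of_expIntegral_lt_top (τ : LevyTriplet d) {t₀ δ : ℝ} (ht₀ : 0 < t₀)
    (hδ : 0 < δ) (hI : τ.expIntegral t₀ < ∞) :
    ∃ κ > (0 : ℝ), ∀ x : EuclideanSpace ℝ (Fin d), δ ≤ ‖x‖ → κ ≤ τ.reExponent x := by
  set v := volume (Metric.ball (0 : EuclideanSpace ℝ (Fin d)) (δ / 2)) with hv
  have hv0 : v ≠ 0 := (Metric.measure_ball_pos _ _ (half_pos hδ)).ne'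
  have hvt : v ≠ ∞ := measure_ball_lt_top.ne
  set K := (τ.expIntegral t₀ / v).toReal with hK
  have hKI : τ.expIntegral t₀ ≤ ENNReal.ofReal K * v := by
    rw [hK, ENNReal.ofReal_toReal (ENNReal.div_lt_top hI.ne hv0).ne,
      ENNReal.div_mul_cancel hv0 hvt]
  have hK0 : 0 ≤ K := ENNReal.toReal_nonneg
  set β := t₀ * (2 * τ.h δ⁻¹) with hβ
  obtain ⟨n, hn⟩ := exists_nat_gt (K * Real.exp (2 + 2 * β))
  have hn0' : (0 : ℝ) < n := lt_of_le_of_lt (by positivity) hn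
  refine ⟨1 / ((n : ℝ) ^ 2 * t₀), by positivity, fun x hx => ?_⟩
  have h1 := τ.one_lt_mul_reExponent hδ hx ht₀.le (fun y hy => τ.reExponent_le_h hy)
    hβ.ge hKI (by exact_mod_cast hn0') hn
  rw [div_le_iff₀ (by positivity)]
  linarith

lemma exists_expIntegral_le_of_scaling (τ : LevyTriplet d) (hd : 1 ≤ d)
    (h_zero : Tendsto τ.h (𝓝[>] 0) atTop) {T c α t₀ : ℝ} (hT : 0 < T)
    (hc : c ∈ Set.Ioc (0 : ℝ) 1) (hα : 0 < α)
    (hlower : ∀ x : EuclideanSpace ℝ (Fin d), ‖x‖ < 1 / T →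
      c * τ.charExponentStar ‖x‖ ≤ τ.reExponent x)
    (hscale : ∀ l r : ℝ, 0 < l → l ≤ 1 → 0 < r → r < 1 / T →
      τ.charExponentStar (l * r) ≤ (1 / c) * l ^ α * τ.charExponentStar r)
    (ht₀ : 0 < t₀) (hI : τ.expIntegral t₀ < ∞) :
    ∃ T' > (0 : ℝ), ∃ C > (0 : ℝ), ∀ t : ℝ, T' < t →
      τ.expIntegral t ≤ ENNReal.ofReal (C * (τ.hInv (1 / t)) ^ (-(d : ℤ))) := by
  obtain ⟨hc0, hc1⟩ := hc
  have hd0 : (0 : ℝ) < d := by exact_mod_cast hd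
  obtain ⟨κ, hκ0, hκ⟩ := τ.exists_le_reExponent_of_expIntegral_lt_top ht₀
    (one_div_pos.2 hT) hI
  set m := c ^ 2 / (16 * d) with hm
  have hm0 : 0 < m := by positivity
  set J := ∫ u : EuclideanSpace ℝ (Fin d), Real.exp (-m * ‖u‖ ^ α) with hJ
  have hJ0 : 0 ≤ J := integral_nonneg fun u => (Real.exp_pos _).le
  -- `h(r) ≤ M r⁻ᵅ` for `r > 2 T`, so `h⁻¹(1/t)` grows at most polynomially.
  set M := 16 * d * (1 / c * (2 * T) ^ α * τ.charExponentStar (2 * T)⁻¹) with hM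
  have hM0 : 0 ≤ M := by
    have := τ.charExponentStar_nonneg (r := (2 * T)⁻¹) (by positivity)
    positivity
  have hdecay : ∀ᶠ t : ℝ in atTop,
      M ^ (d / α) * (t ^ (d / α) * Real.exp (-κ * t)) < 1 := by
    have h1 := (tendsto_rpow_mul_exp_neg_mul_atTop_nhds_zero (d / α) κ hκ0).const_mul
      (M ^ (d / α))
    rw [mul_zero] at h1
    exact h1.eventually_lt_const one_pos
  obtain ⟨T₁, hT₁⟩ := eventually_atTop.1 hdecay
  have h2T : 0 < 2 * T := by positivity
  have hh2T := τ.h_pos h_zero h2T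
  refine ⟨max (max T₁ t₀) (1 / τ.h (2 * T)), by positivity,
    Real.exp m * J + Real.exp (t₀ * κ) * (τ.expIntegral t₀).toReal + 1, by positivity,
    fun t ht => ?_⟩
  have htT₁ : T₁ ≤ t := (((le_max_left _ _).trans (le_max_left _ _)).trans_lt ht).le
  have htt₀ : t₀ < t := ((le_max_right _ _).trans (le_max_left _ _)).trans_lt ht
  have hth : 1 / τ.h (2 * T) < t := (le_max_right _ _).trans_lt ht
  have ht0 : 0 < t := ht₀.trans htt₀
  set r := τ.hInv (1 / t) with hr
  have hr0 : 0 < r := τ.hInv_pos h_zero (one_div_pos.2 ht0)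
  have hhr : τ.h r = 1 / t := τ.h_hInv h_zero (one_div_pos.2 ht0)
  have hrT : 2 * T ≤ r := by
    rw [hr, τ.le_hInv_iff h_zero h2T (one_div_pos.2 ht0)]
    exact ((one_div_lt ht0 hh2T).2 hth).le
  have hhS : 1 / t ≤ 16 * d * τ.charExponentStar r⁻¹ := by
    have := τ.h_le_charExponentStar hd (inv_pos.2 hr0)
    rwa [inv_inv, hhr] at this
  -- The polynomial growth of `r` in `t` is beaten by `exp (-κ t)`.
  have hrgrow : r ^ d * Real.exp (-κ * t) ≤ 1 := by
    have h1 := hscale (2 * T / r) (2 * T)⁻¹ (by positivity) ((div_le_one hr0).2 hrT)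
      (by positivity) (by rw [one_div]; exact inv_strictAnti₀ hT (by linarith))
    rw [show 2 * T / r * (2 * T)⁻¹ = r⁻¹ by field_simp, Real.div_rpow h2T.le hr0.le] at h1
    have h2 : 1 / t ≤ M / r ^ α := by
      refine hhS.trans ((mul_le_mul_of_nonneg_left h1 (by positivity)).trans (le_of_eq ?_))
      rw [hM]
      ring
    have h3 : r ^ α ≤ M * t := by
      have : 0 < r ^ α := by positivity
      rw [div_le_div_iff₀ ht0 this] at h2
      linarith
    have h4 : r ^ d ≤ (M * t) ^ (d / α) := by
      have h5 := Real.rpow_le_rpow (by positivity) h3 (z := d / α) (by positivity)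
      rwa [← Real.rpow_mul hr0.le, mul_div_cancel₀ _ hα.ne', Real.rpow_natCast] at h5
    rw [Real.mul_rpow hM0 ht0.le] at h4
    have h6 := hT₁ t htT₁
    have h7 := mul_le_mul_of_nonneg_right h4 (Real.exp_pos (-κ * t)).le
    linarith
  -- Lower bound for `t Re ψ` on the ball of radius `1 / T`.
  have hnear : ∀ z : EuclideanSpace ℝ (Fin d), ‖z‖ < 1 / T →
      m * ‖r • z‖ ^ α - m ≤ t * τ.reExponent z := by
    intro z hz
    have hz0 := norm_nonneg z
    rw [norm_smul, Real.norm_of_nonneg hr0.le]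
    by_cases hrz : r * ‖z‖ ≤ 1
    · have h1 : (r * ‖z‖) ^ α ≤ 1 := Real.rpow_le_one (by positivity) hrz hα.le
      have h2 : 0 ≤ t * τ.reExponent z := mul_nonneg ht0.le (τ.reExponent_nonneg z)
      nlinarith
    · push Not at hrz
      have hzpos : 0 < ‖z‖ := by
        rcases hz0.eq_or_lt with h | h
        · rw [← h] at hrz; linarith
        · exact h
      have h1 := hscale (r * ‖z‖)⁻¹ ‖z‖ (by positivity) (inv_le_one_of_one_le₀ hrz.le) hzpos hz
      rw [show (r * ‖z‖)⁻¹ * ‖z‖ = r⁻¹ by field_simp, Real.inv_rpow (by positivity)] at h1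
      have h2 := hlower z hz
      set w := (r * ‖z‖) ^ α with hw
      have hw0 : 0 < w := by positivity
      have h3 : 1 / t ≤ 16 * d * (1 / c * w⁻¹ * τ.charExponentStar ‖z‖) :=
        hhS.trans (by gcongr)
      have h4 : m * w ≤ t * (c * τ.charExponentStar ‖z‖) := by
        rw [div_le_iff₀ ht0] at h3
        have h5 := mul_le_mul_of_nonneg_left h3 (by positivity : 0 ≤ m * w)
        have e : m * w * (16 * d * (1 / c * w⁻¹ * τ.charExponentStar ‖z‖) * t)
            = t * (c * τ.charExponentStar ‖z‖) := by
          rw [hm]; field_simp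
        rwa [e, mul_one] at h5
      have h6 := mul_le_mul_of_nonneg_left h2 ht0.le
      linarith
  have hpoint : ∀ z : EuclideanSpace ℝ (Fin d), ENNReal.ofReal (Real.exp (-t * τ.reExponent z))
      ≤ ENNReal.ofReal (Real.exp m) * ENNReal.ofReal (Real.exp (-m * ‖r • z‖ ^ α))
        + ENNReal.ofReal (Real.exp (-(t - t₀) * κ))
          * ENNReal.ofReal (Real.exp (-t₀ * τ.reExponent z)) := by
    intro z
    rw [← ENNReal.ofReal_mul (Real.exp_pos _).le, ← ENNReal.ofReal_mul (Real.exp_pos _).le,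
      ← Real.exp_add, ← Real.exp_add]
    by_cases hz : ‖z‖ < 1 / T
    · refine le_add_right (ENNReal.ofReal_le_ofReal (Real.exp_le_exp.2 ?_))
      linarith [hnear z hz]
    · refine le_add_left (ENNReal.ofReal_le_ofReal (Real.exp_le_exp.2 ?_))
      have := hκ z (not_lt.1 hz)
      nlinarith
  have hmeas : Measurable fun z : EuclideanSpace ℝ (Fin d) =>
      ENNReal.ofReal (Real.exp m) * ENNReal.ofReal (Real.exp (-m * ‖r • z‖ ^ α)) := by
    fun_prop
  calc τ.expIntegral t
      ≤ ∫⁻ z : EuclideanSpace ℝ (Fin d),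
          (ENNReal.ofReal (Real.exp m) * ENNReal.ofReal (Real.exp (-m * ‖r • z‖ ^ α))
          + ENNReal.ofReal (Real.exp (-(t - t₀) * κ))
          * ENNReal.ofReal (Real.exp (-t₀ * τ.reExponent z))) := lintegral_mono hpoint
    _ = ENNReal.ofReal (Real.exp m) * ENNReal.ofReal ((r ^ d)⁻¹ * J)
        + ENNReal.ofReal (Real.exp (-(t - t₀) * κ)) * τ.expIntegral t₀ := by
        rw [lintegral_add_left hmeas, lintegral_const_mul' _ _ ENNReal.ofReal_ne_top,
          lintegral_const_mul' _ _ ENNReal.ofReal_ne_top,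
          lintegral_exp_neg_mul_norm_rpow_smul hd hm0 hα hr0]
        rfl
    _ = ENNReal.ofReal (Real.exp m * ((r ^ d)⁻¹ * J)
        + Real.exp (-(t - t₀) * κ) * (τ.expIntegral t₀).toReal) := by
        conv_lhs => rw [← ENNReal.ofReal_toReal hI.ne]
        rw [← ENNReal.ofReal_mul (Real.exp_pos _).le, ← ENNReal.ofReal_mul (Real.exp_pos _).le,
          ← ENNReal.ofReal_add (by positivity) (by positivity)]
    _ ≤ _ := by
        refine ENNReal.ofReal_le_ofReal ?_
        rw [zpow_neg, zpow_natCast, ← div_eq_mul_inv, le_div_iff₀ (by positivity)]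
        have e1 : Real.exp (-(t - t₀) * κ) = Real.exp (t₀ * κ) * Real.exp (-κ * t) := by
          rw [← Real.exp_add]; congr 1; ring
        have e2 : (Real.exp m * ((r ^ d)⁻¹ * J)
              + Real.exp (-(t - t₀) * κ) * (τ.expIntegral t₀).toReal) * r ^ d
            = Real.exp m * J + Real.exp (t₀ * κ) * (τ.expIntegral t₀).toReal
              * (r ^ d * Real.exp (-κ * t)) := by
          rw [e1]; field_simp
        rw [e2]
        have h8 : Real.exp (t₀ * κ) * (τ.expIntegral t₀).toReal * (r ^ d * Real.exp (-κ * t))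
            ≤ Real.exp (t₀ * κ) * (τ.expIntegral t₀).toReal * 1 := by gcongr
        linarith

end LevyTriplet

/-! ### Gaussian smoothing of characteristic functions -/

section Fourier

variable {E : Type*} [NormedAddCommGroup E] [InnerProductSpace ℝ E] [FiniteDimensional ℝ E]
  [MeasurableSpace E] [BorelSpace E]

lemma integrable_rexp_neg_mul_sq_norm {a : ℝ} (ha : 0 < a) :
    Integrable fun z : E => Real.exp (-a * ‖z‖ ^ 2) := by
  have h := GaussianFourier.integrable_cexp_neg_mul_sq_norm_add (V := E) (b := (a : ℂ))
    (by simpa using ha) 0 0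
  refine h.norm.congr (ae_of_all _ fun z => ?_)
  simp only [zero_mul, add_zero, Complex.norm_exp]
  congr 1
  rw [← Complex.ofReal_pow, ← Complex.ofReal_neg, ← Complex.ofReal_mul, Complex.ofReal_re]

/-- Fourier inversion with a Gaussian convergence factor. -/
lemma integral_charFun_mul_gaussian (μ : Measure E) [IsFiniteMeasure μ] {a : ℝ} (ha : 0 < a)
    (x : E) :
    ∫ z, charFun μ z * Complex.exp (-a * ‖z‖ ^ 2 - Complex.I * (inner ℝ x z : ℝ))
      = (((Real.pi / a) ^ ((Module.finrank ℝ E : ℝ) / 2)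
        * ∫ y, Real.exp (-(1 / (4 * a)) * ‖y - x‖ ^ 2) ∂μ : ℝ) : ℂ) := by
  set F : E → E → ℂ := fun z y =>
    Complex.exp (-a * ‖z‖ ^ 2 + Complex.I * (inner ℝ (y - x) z : ℝ)) with hF
  have hnorm : ∀ z y, ‖F z y‖ = Real.exp (-a * ‖z‖ ^ 2) := by
    intro z y
    rw [hF, Complex.norm_exp]
    congr 1
    simp [← Complex.ofReal_pow]
  have hint : Integrable (Function.uncurry F) ((volume : Measure E).prod μ) := by
    refine ((integrable_rexp_neg_mul_sq_norm ha).comp_fst μ).mono' ?_ (ae_of_all _ fun p => ?_)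
    · exact Continuous.aestronglyMeasurable (by fun_prop)
    · exact (hnorm _ _).le
  have h1 : ∀ z, charFun μ z * Complex.exp (-a * ‖z‖ ^ 2 - Complex.I * (inner ℝ x z : ℝ))
      = ∫ y, F z y ∂μ := by
    intro z
    rw [charFun_apply, ← integral_mul_const]
    congr 1 with y
    rw [hF, ← Complex.exp_add]
    congr 1
    rw [inner_sub_left, Complex.ofReal_sub]
    ring
  simp_rw [h1]
  rw [integral_integral_swap hint, Complex.ofReal_mul, ← integral_complex_ofReal,
    ← integral_const_mul]
  congr 1 with y
  rw [hF, GaussianFourier.integral_cexp_neg_mul_sq_norm_add (by simpa using ha),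
    Complex.I_sq, Complex.ofReal_cpow (by positivity)]
  push_cast
  congr 2
  ring

lemma integral_gaussian_le_lintegral_norm_charFun (μ : Measure E) [IsFiniteMeasure μ] {a : ℝ}
    (ha : 0 < a) (x : E) :
    ENNReal.ofReal ((Real.pi / a) ^ ((Module.finrank ℝ E : ℝ) / 2)
        * ∫ y, Real.exp (-(1 / (4 * a)) * ‖y - x‖ ^ 2) ∂μ)
      ≤ ∫⁻ z, ‖charFun μ z‖ₑ := by
  have h := integral_charFun_mul_gaussian μ ha x
  have h0 : 0 ≤ (Real.pi / a) ^ ((Module.finrank ℝ E : ℝ) / 2)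
        * ∫ y, Real.exp (-(1 / (4 * a)) * ‖y - x‖ ^ 2) ∂μ :=
    mul_nonneg (by positivity) (integral_nonneg fun y => (Real.exp_pos _).le)
  have h2 := enorm_integral_le_lintegral_enorm (μ := volume)
    (fun z => charFun μ z * Complex.exp (-a * ‖z‖ ^ 2 - Complex.I * (inner ℝ x z : ℝ)))
  rw [h, ← ofReal_norm, Complex.norm_real, Real.norm_of_nonneg h0] at h2
  refine h2.trans (lintegral_mono fun z => ?_)
  rw [← ofReal_norm, ← ofReal_norm]
  refine ENNReal.ofReal_le_ofReal ?_
  rw [norm_mul, Complex.norm_exp]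
  refine mul_le_of_le_one_right (norm_nonneg _) (Real.exp_le_one_iff.2 ?_)
  simp [← Complex.ofReal_pow]
  positivity

/-- The measure of a ball of radius `r` is `O(rᵈ)` when the characteristic function is
integrable. -/
lemma measure_closedBall_le_lintegral_norm_charFun (μ : Measure E) [IsFiniteMeasure μ] {r : ℝ}
    (hr : 0 < r) (x : E) :
    μ (Metric.closedBall x r)
      ≤ ENNReal.ofReal (Real.exp (1 / 4) * r ^ Module.finrank ℝ E) * ∫⁻ z, ‖charFun μ z‖ₑ := by
  set D := Module.finrank ℝ E with hD
  have hr2 : 0 < r ^ 2 := by positivity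
  have h := integral_gaussian_le_lintegral_norm_charFun μ hr2 x
  set b := 1 / (4 * r ^ 2) with hb
  set I := ∫ y, Real.exp (-b * ‖y - x‖ ^ 2) ∂μ with hI
  have hI0 : 0 ≤ I := integral_nonneg fun y => (Real.exp_pos _).le
  have hint : Integrable (fun y => Real.exp (-b * ‖y - x‖ ^ 2)) μ := by
    refine (integrable_const (1 : ℝ)).mono' (Continuous.aestronglyMeasurable (by fun_prop))
      (ae_of_all _ fun y => ?_)
    rw [Real.norm_of_nonneg (Real.exp_pos _).le, Real.exp_le_one_iff]
    have : 0 ≤ b * ‖y - x‖ ^ 2 := by positivity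
    linarith
  have hball : μ (Metric.closedBall x r) ≤ ENNReal.ofReal (Real.exp (1 / 4) * I) := by
    rw [hI, ← integral_const_mul, ofReal_integral_eq_lintegral_ofReal (hint.const_mul _)
      (ae_of_all _ fun y => by positivity), ← lintegral_indicator_one measurableSet_closedBall]
    refine lintegral_mono fun y => ?_
    refine Set.indicator_le' (s := Metric.closedBall x r) (f := (1 : E → ℝ≥0∞))
      (g := fun y => ENNReal.ofReal (Real.exp (1 / 4) * Real.exp (-b * ‖y - x‖ ^ 2)))
      (fun y hy => ?_) (fun y hy => zero_le) y
    rw [Pi.one_apply, ENNReal.one_le_ofReal, ← Real.exp_add, Real.one_le_exp_iff]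
    rw [mem_closedBall_iff_norm] at hy
    have h1 : b * ‖y - x‖ ^ 2 ≤ b * r ^ 2 := by gcongr
    have h2 : b * r ^ 2 = 1 / 4 := by rw [hb]; field_simp
    linarith
  have hpi : 1 ≤ Real.pi ^ ((D : ℝ) / 2) :=
    Real.one_le_rpow (by linarith [Real.pi_gt_three]) (by positivity)
  have hrD : (r ^ 2) ^ ((D : ℝ) / 2) = r ^ D := by
    rw [← Real.rpow_natCast r 2, ← Real.rpow_mul hr.le, ← Real.rpow_natCast r D]
    congr 1
    push_cast
    ring
  have hI' : Real.exp (1 / 4) * I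
      ≤ Real.exp (1 / 4) * r ^ D * ((Real.pi / r ^ 2) ^ ((D : ℝ) / 2) * I) := by
    rw [Real.div_rpow Real.pi_pos.le hr2.le, hrD]
    have e : Real.exp (1 / 4) * r ^ D * (Real.pi ^ ((D : ℝ) / 2) / r ^ D * I)
        = Real.pi ^ ((D : ℝ) / 2) * (Real.exp (1 / 4) * I) := by field_simp
    rw [e]
    exact le_mul_of_one_le_left (by positivity) hpi
  refine hball.trans ((ENNReal.ofReal_le_ofReal hI').trans ?_)
  rw [ENNReal.ofReal_mul (by positivity)]
  gcongr

lemma measure_le_smul_of_closedBall_le (μ ν : Measure E) [IsFiniteMeasure μ]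
    [IsLocallyFiniteMeasure ν]
    (h : ∀ x r, 0 < r → μ (Metric.closedBall x r) ≤ ν (Metric.closedBall x r)) : μ ≤ ν := by
  refine Measure.le_iff'.2 fun s => ?_
  refine (Besicovitch.vitaliFamily μ).measure_le_of_frequently_le ν
    Measure.AbsolutelyContinuous.rfl s fun x _ => ?_
  refine (Besicovitch.tendsto_filterAt μ x).frequently (Eventually.frequently ?_)
  filter_upwards [self_mem_nhdsWithin] with r hr
  exact h x r hr

lemma exists_density_le {μ : Measure E} [IsFiniteMeasure μ] {C : ℝ≥0∞}
    (h : μ ≤ C • (volume : Measure E)) :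
    ∃ p : E → ℝ≥0∞, Measurable p ∧ μ = (volume : Measure E).withDensity p ∧ ⨆ x, p x ≤ C := by
  have hac : μ ≪ (volume : Measure E) := Measure.absolutelyContinuous_of_le_smul h
  have hp := Measure.withDensity_rnDeriv_eq μ volume hac
  have hae : μ.rnDeriv volume ≤ᵐ[volume] fun _ => C := by
    refine ae_le_of_forall_setLIntegral_le_of_sigmaFinite (Measure.measurable_rnDeriv _ _)
      fun s hs _ => ?_
    rw [← withDensity_apply _ hs, hp, setLIntegral_const]
    exact h s
  refine ⟨fun x => min (μ.rnDeriv volume x) C, (Measure.measurable_rnDeriv _ _).min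
    measurable_const, ?_, iSup_le fun x => min_le_right _ _⟩
  conv_lhs => rw [← hp]
  refine withDensity_congr_ae ?_
  filter_upwards [hae] with x hx
  exact (min_eq_left hx).symm

/-- A finite measure with integrable characteristic function has a bounded density. -/
lemma exists_density_le_lintegral_norm_charFun (μ : Measure E) [IsFiniteMeasure μ]
    (hfin : ∫⁻ z, ‖charFun μ z‖ₑ ≠ ∞) :
    ∃ p : E → ℝ≥0∞, Measurable p ∧ μ = (volume : Measure E).withDensity p ∧
      ⨆ x, p x ≤ ENNReal.ofReal (Real.exp (1 / 4)) / volume (Metric.ball (0 : E) 1)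
        * ∫⁻ z, ‖charFun μ z‖ₑ := by
  set v := volume (Metric.ball (0 : E) 1) with hv
  have hv0 : v ≠ 0 := (Metric.measure_ball_pos _ _ one_pos).ne'
  have hvt : v ≠ ∞ := measure_ball_lt_top.ne
  set C := ENNReal.ofReal (Real.exp (1 / 4)) / v * ∫⁻ z, ‖charFun μ z‖ₑ with hC
  have hCt : C ≠ ∞ := ENNReal.mul_ne_top (ENNReal.div_ne_top ENNReal.ofReal_ne_top hv0) hfin
  have : IsLocallyFiniteMeasure (C • (volume : Measure E)) := by
    rw [← ENNReal.coe_toNNReal hCt]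
    exact inferInstanceAs (IsLocallyFiniteMeasure (C.toNNReal • (volume : Measure E)))
  refine exists_density_le (measure_le_smul_of_closedBall_le _ _ fun x r hr => ?_)
  refine (measure_closedBall_le_lintegral_norm_charFun μ hr x).trans (le_of_eq ?_)
  rw [Measure.smul_apply, Measure.addHaar_closedBall _ _ hr.le, ← hv, smul_eq_mul, hC,
    ENNReal.ofReal_mul (Real.exp_pos _).le]
  calc _ = ENNReal.ofReal (Real.exp (1 / 4)) * (∫⁻ z, ‖charFun μ z‖ₑ)
        * ENNReal.ofReal (r ^ Module.finrank ℝ E) * (v⁻¹ * v) := by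
        rw [ENNReal.inv_mul_cancel hv0 hvt, mul_one]; ring
    _ = _ := by rw [div_eq_mul_inv _ v]; ring

lemma charFun_conv_map_neg (μ : Measure E) [IsFiniteMeasure μ] (z : E) :
    charFun (μ.conv (μ.map fun x => (-1 : ℝ) • x)) z = ((‖charFun μ z‖ ^ 2 : ℝ) : ℂ) := by
  rw [charFun_conv, charFun_map_smul, neg_one_smul, charFun_neg, Complex.mul_conj,
    Complex.normSq_eq_norm_sq]

/-- The inequality half of Plancherel's theorem: a density bounded by `M` gives
`∫ |φ|² ≤ (2π)ᵈ M`. The proof tests the symmetrized law against Gaussians. -/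
lemma lintegral_norm_charFun_sq_le (μ : Measure E) [IsProbabilityMeasure μ] {p : E → ℝ≥0∞}
    (hp : Measurable p) (hμ : μ = (volume : Measure E).withDensity p) {M : ℝ≥0∞}
    (hM : ∀ x, p x ≤ M) :
    ∫⁻ z, ENNReal.ofReal (‖charFun μ z‖ ^ 2)
      ≤ ENNReal.ofReal ((2 * Real.pi) ^ Module.finrank ℝ E) * M := by
  set D := Module.finrank ℝ E with hD
  have hsmooth : ∀ a : ℝ, 0 < a →
      ∫⁻ z, ENNReal.ofReal (‖charFun μ z‖ ^ 2 * Real.exp (-a * ‖z‖ ^ 2))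
        ≤ ENNReal.ofReal ((2 * Real.pi) ^ D) * M := by
    intro a ha
    set ν := μ.map fun x => (-1 : ℝ) • x with hν
    have : IsProbabilityMeasure ν := Measure.isProbabilityMeasure_map (by fun_prop)
    set b := 1 / (4 * a) with hb
    have hb0 : 0 < b := by positivity
    have hint : Integrable fun z : E => ‖charFun μ z‖ ^ 2 * Real.exp (-a * ‖z‖ ^ 2) := by
      refine (integrable_rexp_neg_mul_sq_norm (E := E) ha).mono'
        (Measurable.aestronglyMeasurable (by fun_prop)) (ae_of_all _ fun z => ?_)
      rw [Real.norm_of_nonneg (by positivity)]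
      refine mul_le_of_le_one_left (Real.exp_pos _).le ?_
      exact pow_le_one₀ (norm_nonneg _) (norm_charFun_le_one z)
    have hid : ∫ z : E, ‖charFun μ z‖ ^ 2 * Real.exp (-a * ‖z‖ ^ 2)
        = (Real.pi / a) ^ ((D : ℝ) / 2)
          * ∫ y, Real.exp (-b * ‖y‖ ^ 2) ∂(μ.conv ν) := by
      have h := integral_charFun_mul_gaussian (μ.conv ν) ha 0
      rw [← Complex.ofReal_inj]
      simp only [inner_zero_left, Complex.ofReal_zero, mul_zero, sub_zero] at h
      rw [← h, ← integral_complex_ofReal]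
      congr 1 with z
      rw [hν, charFun_conv_map_neg, Complex.ofReal_mul, Complex.ofReal_exp]
      push_cast
      rfl
    have hgint : Integrable (fun y => Real.exp (-b * ‖y‖ ^ 2)) (μ.conv ν) := by
      refine (integrable_const (1 : ℝ)).mono' (Continuous.aestronglyMeasurable (by fun_prop))
        (ae_of_all _ fun y => ?_)
      rw [Real.norm_of_nonneg (Real.exp_pos _).le, Real.exp_le_one_iff]
      have : 0 ≤ b * ‖y‖ ^ 2 := by positivity
      linarith
    set g : E → ℝ≥0∞ := fun y => ENNReal.ofReal (Real.exp (-b * ‖y‖ ^ 2)) with hg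
    have hgm : Measurable g := by fun_prop
    have hgauss : ∫⁻ y, g y = ENNReal.ofReal ((Real.pi / b) ^ ((D : ℝ) / 2)) := by
      rw [hg, ← ofReal_integral_eq_lintegral_ofReal (integrable_rexp_neg_mul_sq_norm hb0)
        (ae_of_all _ fun _ => (Real.exp_pos _).le),
        GaussianFourier.integral_rexp_neg_mul_sq_norm hb0]
    have hconv : ∫⁻ y, g y ∂(μ.conv ν) ≤ M * ENNReal.ofReal ((Real.pi / b) ^ ((D : ℝ) / 2)) := by
      rw [Measure.lintegral_conv hgm]
      have hx : ∀ x, ∫⁻ y, g (x + y) ∂ν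
          ≤ M * ENNReal.ofReal ((Real.pi / b) ^ ((D : ℝ) / 2)) := by
        intro x
        rw [hν, lintegral_map (by fun_prop) (by fun_prop)]
        conv_lhs => rw [hμ]
        rw [lintegral_withDensity_eq_lintegral_mul _ hp (by fun_prop)]
        calc ∫⁻ y, (p * fun y => g (x + (-1 : ℝ) • y)) y
            ≤ ∫⁻ y, M * g (x - y) := by
              refine lintegral_mono fun y => ?_
              rw [Pi.mul_apply, neg_one_smul, ← sub_eq_add_neg]
              gcongr
              exact hM y
          _ = M * ENNReal.ofReal ((Real.pi / b) ^ ((D : ℝ) / 2)) := by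
              rw [lintegral_const_mul _ (by fun_prop), lintegral_sub_left_eq_self, hgauss]
      refine (lintegral_mono hx).trans ?_
      rw [lintegral_const, measure_univ, mul_one]
    have hconst : (Real.pi / a) ^ ((D : ℝ) / 2) * (Real.pi / b) ^ ((D : ℝ) / 2)
        = (2 * Real.pi) ^ D := by
      rw [← Real.mul_rpow (by positivity) (by positivity),
        show Real.pi / a * (Real.pi / b) = (2 * Real.pi) ^ 2 by rw [hb]; field_simp; ring,
        ← Real.rpow_natCast _ 2, ← Real.rpow_mul (by positivity), ← Real.rpow_natCast _ D]
      congr 1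
      push_cast
      ring
    rw [← ofReal_integral_eq_lintegral_ofReal hint (ae_of_all _ fun _ => by positivity), hid,
      ENNReal.ofReal_mul (by positivity), ofReal_integral_eq_lintegral_ofReal hgint
      (ae_of_all _ fun _ => (Real.exp_pos _).le), ← hconst, ENNReal.ofReal_mul (by positivity),
      mul_assoc, mul_comm _ M]
    gcongr
  -- Let the smoothing parameter tend to zero and apply Fatou's lemma.
  have hlim : ∀ z : E, Tendsto (fun n : ℕ =>
      ENNReal.ofReal (‖charFun μ z‖ ^ 2 * Real.exp (-(1 / ((n : ℝ) + 1)) * ‖z‖ ^ 2))) atTop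
      (𝓝 (ENNReal.ofReal (‖charFun μ z‖ ^ 2))) := by
    intro z
    refine ENNReal.tendsto_ofReal ?_
    have h1 := (((tendsto_one_div_add_atTop_nhds_zero_nat (𝕜 := ℝ)).neg.mul_const
      (‖z‖ ^ 2)).rexp).const_mul (‖charFun μ z‖ ^ 2)
    simpa using h1
  calc ∫⁻ z, ENNReal.ofReal (‖charFun μ z‖ ^ 2)
      = ∫⁻ z, liminf (fun n : ℕ =>
        ENNReal.ofReal (‖charFun μ z‖ ^ 2 * Real.exp (-(1 / ((n : ℝ) + 1)) * ‖z‖ ^ 2))) atTop :=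
        lintegral_congr fun z => (hlim z).liminf_eq.symm
    _ ≤ liminf (fun n : ℕ => ∫⁻ z,
        ENNReal.ofReal (‖charFun μ z‖ ^ 2 * Real.exp (-(1 / ((n : ℝ) + 1)) * ‖z‖ ^ 2))) atTop :=
        lintegral_liminf_le fun n => by fun_prop
    _ ≤ _ := by
        refine liminf_le_of_le (by isBoundedDefault) fun b hb => ?_
        obtain ⟨n, hn⟩ := hb.exists
        exact hn.trans (hsmooth _ (by positivity))

end Fourier

/-! ### The four conditions for a Lévy process -/

namespace LevyTriplet

variable {d : ℕ}

lemma lintegral_exp_re_charExponent (τ : LevyTriplet d) (t : ℝ) :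
    ∫⁻ z, ENNReal.ofReal (Real.exp (-t * (τ.charExponent z).re)) = τ.expIntegral t := by
  simp only [re_charExponent, expIntegral]

lemma norm_cexp_charExponent (τ : LevyTriplet d) (t : ℝ) (z : EuclideanSpace ℝ (Fin d)) :
    ‖Complex.exp (-(t : ℂ) * τ.charExponent z)‖ = Real.exp (-t * τ.reExponent z) := by
  rw [Complex.norm_exp, ← re_charExponent, ← Complex.ofReal_neg, Complex.re_ofReal_mul]

end LevyTriplet

section LawOfIncrement

variable {d : ℕ} {Ω : Type*} [MeasurableSpace Ω] {P : Measure Ω}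
  {Y : ℝ≥0 → Ω → EuclideanSpace ℝ (Fin d)} {τ : LevyTriplet d}

/-- Measurability of `exp (-t₀ ψ)` is inherited from the characteristic function of `Y_{t₀}`. -/
lemma HasGeneratingTriplet.integrable_cexp_iff [IsProbabilityMeasure P]
    (hτ : HasGeneratingTriplet P Y τ) {t₀ : ℝ} (ht₀ : 0 < t₀) :
    Integrable (fun z => Complex.exp (-(t₀ : ℂ) * τ.charExponent z)) ↔ τ.expIntegral t₀ < ∞ := by
  have hmeas : AEStronglyMeasurable (fun z => Complex.exp (-(t₀ : ℂ) * τ.charExponent z))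
      volume := by
    have h := (measurable_charFun (μ := P.map (Y ⟨t₀, ht₀.le⟩))).aestronglyMeasurable
      (μ := (volume : Measure (EuclideanSpace ℝ (Fin d))))
    refine h.congr (ae_of_all _ fun z => ?_)
    exact hτ ⟨t₀, ht₀.le⟩ z
  rw [Integrable, and_iff_right hmeas, hasFiniteIntegral_iff_norm]
  simp only [τ.norm_cexp_charExponent, LevyTriplet.expIntegral]

lemma HasGeneratingTriplet.lintegral_enorm_charFun (hτ : HasGeneratingTriplet P Y τ) (t : ℝ≥0) :
    ∫⁻ z, ‖charFun (P.map (Y t)) z‖ₑ = τ.expIntegral t := by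
  refine lintegral_congr fun z => ?_
  rw [← ofReal_norm, hτ t z, τ.norm_cexp_charExponent]

lemma HasGeneratingTriplet.exists_density_of_expIntegral_le [IsProbabilityMeasure P]
    (hY : IsLevyProcess P Y) (hτ : HasGeneratingTriplet P Y τ) {t : ℝ≥0} {C : ℝ}
    (h : τ.expIntegral t ≤ ENNReal.ofReal C) :
    ∃ p : EuclideanSpace ℝ (Fin d) → ℝ≥0∞, IsDensityOf P (Y t) p ∧
      ⨆ x, p x ≤ ENNReal.ofReal (Real.exp (1 / 4) / unitBallVolume d * C) := by
  have hprob : IsProbabilityMeasure (P.map (Y t)) :=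
    Measure.isProbabilityMeasure_map (hY.measurable t).aemeasurable
  have hch := hτ.lintegral_enorm_charFun t
  obtain ⟨p, hp, hpd, hps⟩ := exists_density_le_lintegral_norm_charFun (P.map (Y t))
    (by rw [hch]; exact (h.trans_lt ENNReal.ofReal_lt_top).ne)
  refine ⟨p, ⟨hp, hpd⟩, hps.trans ?_⟩
  have hω := unitBallVolume_pos d
  rw [hch, ENNReal.ofReal_mul (by positivity), ENNReal.ofReal_div_of_pos hω, unitBallVolume,
    ENNReal.ofReal_toReal measure_ball_lt_top.ne]
  gcongr

lemma HasGeneratingTriplet.expIntegral_two_mul_le [IsProbabilityMeasure P]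
    (hY : IsLevyProcess P Y) (hτ : HasGeneratingTriplet P Y τ) {t : ℝ≥0} {C : ℝ}
    {p : EuclideanSpace ℝ (Fin d) → ℝ≥0∞} (hp : IsDensityOf P (Y t) p)
    (hC : ⨆ x, p x ≤ ENNReal.ofReal C) :
    τ.expIntegral (2 * t) ≤ ENNReal.ofReal ((2 * Real.pi) ^ d * C) := by
  have hprob : IsProbabilityMeasure (P.map (Y t)) :=
    Measure.isProbabilityMeasure_map (hY.measurable t).aemeasurable
  have h := lintegral_norm_charFun_sq_le (P.map (Y t)) hp.1 hp.2 fun x => (le_iSup p x).trans hC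
  rw [finrank_euclideanSpace_fin, ← ENNReal.ofReal_mul (by positivity)] at h
  refine le_trans (le_of_eq ?_) h
  refine lintegral_congr fun z => ?_
  rw [hτ t z, τ.norm_cexp_charExponent, ← Real.exp_nat_mul]
  congr 2
  push_cast
  ring

end LawOfIncrement

/-- A bound for `∫ exp (-2 t Re ψ)` in terms of `h⁻¹(1/t)` is as good as one in terms of
`h⁻¹(1/(2t))`, since the bound itself forces the two to be comparable. -/
lemma LevyTriplet.exists_expIntegral_le_of_two_mul {d : ℕ} (τ : LevyTriplet d) (hd : 1 ≤ d)
    (h_zero : Tendsto τ.h (𝓝[>] 0) atTop) {T C : ℝ} (hT : 0 < T) (hC : 0 < C)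
    (hbound : ∀ t, T < t →
      τ.expIntegral (2 * t) ≤ ENNReal.ofReal (C * (τ.hInv (1 / t)) ^ (-(d : ℤ)))) :
    ∃ C' > (0 : ℝ), ∀ t, 2 * T < t →
      τ.expIntegral t ≤ ENNReal.ofReal (C' * (τ.hInv (1 / t)) ^ (-(d : ℤ))) := by
  obtain ⟨c, ⟨hc0, -⟩, hch⟩ := τ.exists_mul_h_le hd h_zero two_pos hT hC two_pos hbound
  refine ⟨C * (c ^ d)⁻¹, by positivity, fun t ht => ?_⟩
  have ht0 : 0 < t := by linarith
  set r := τ.hInv (1 / t) with hr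
  have hr0 : 0 < r := τ.hInv_pos h_zero (one_div_pos.2 ht0)
  have hhr : τ.h r = 1 / t := τ.h_hInv h_zero (one_div_pos.2 ht0)
  have hrT : τ.hInv (1 / T) < r := by
    by_contra! hcon
    rw [τ.le_hInv_iff h_zero hr0 (one_div_pos.2 hT), hhr, one_div_le_one_div hT ht0] at hcon
    linarith
  have h1 := hch r hrT
  rw [hhr, show 2 * (1 / t) = 1 / (t / 2) by field_simp] at h1
  have h2 : c * r ≤ τ.hInv (1 / (t / 2)) :=
    (τ.le_hInv_iff h_zero (by positivity) (by positivity)).2 h1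
  have h3 := hbound (t / 2) (by linarith)
  rw [mul_div_cancel₀ t two_ne_zero] at h3
  refine h3.trans (ENNReal.ofReal_le_ofReal ?_)
  rw [zpow_neg, zpow_neg, zpow_natCast, zpow_natCast, mul_assoc, ← mul_inv, ← mul_pow]
  gcongr

theorem mainTheorem5 {d : ℕ} (hd : 1 ≤ d) {Ω : Type*} [MeasurableSpace Ω] (P : Measure Ω)
    [IsProbabilityMeasure P] (Y : ℝ≥0 → Ω → EuclideanSpace ℝ (Fin d)) (hY : IsLevyProcess P Y)
    (τ : LevyTriplet d) (hτ : HasGeneratingTriplet P Y τ)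
    (h_zero : Tendsto τ.h (𝓝[>] 0) atTop) :
    List.TFAE [
      -- (D1)
      ∃ T₁ > (0 : ℝ), ∃ c₁ > (0 : ℝ), ∀ t : ℝ≥0, T₁ < t →
        ∃ p : EuclideanSpace ℝ (Fin d) → ℝ≥0∞, IsDensityOf P (Y t) p ∧
          ⨆ x, p x ≤ ENNReal.ofReal (c₁ * (τ.hInv (1 / (t : ℝ))) ^ (-(d : ℤ))),
      -- (D2)
      ∃ T₂ > (0 : ℝ), ∃ c₂ > (0 : ℝ), ∀ t : ℝ, T₂ < t →
        ∫⁻ z, ENNReal.ofReal (Real.exp (-t * (τ.charExponent z).re))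
          ≤ ENNReal.ofReal (c₂ * (τ.hInv (1 / t)) ^ (-(d : ℤ))),
      -- (D3)
      (∃ T₃ > (0 : ℝ), ∃ c₃ ∈ Set.Ioc (0 : ℝ) 1, ∃ α₃ ∈ Set.Ioc (0 : ℝ) 2,
        (∀ x : EuclideanSpace ℝ (Fin d), ‖x‖ < 1 / T₃ →
          c₃ * τ.charExponentStar ‖x‖ ≤ (τ.charExponent x).re) ∧
        (∀ l r : ℝ, 0 < l → l ≤ 1 → 0 < r → r < 1 / T₃ →
          τ.charExponentStar (l * r) ≤ (1 / c₃) * l ^ α₃ * τ.charExponentStar r)) ∧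
        (∃ t₀ > (0 : ℝ), Integrable (fun z => Complex.exp (-(t₀ : ℂ) * τ.charExponent z))),
      -- (D4)
      (∃ T₄ > (0 : ℝ), ∃ c₄ : ℝ, 1 ≤ c₄ ∧
        ∀ x : EuclideanSpace ℝ (Fin d), ‖x‖ < 1 / T₄ →
          τ.charExponentStar ‖x‖ ≤ c₄ * (τ.quadForm x
            + ∫ z in {z : EuclideanSpace ℝ (Fin d) | |(inner ℝ x z : ℝ)| < 1},
                |(inner ℝ x z : ℝ)| ^ 2 ∂τ.N)) ∧
        (∃ t₀ > (0 : ℝ), Integrable (fun z => Complex.exp (-(t₀ : ℂ) * τ.charExponent z)))] := by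
  tfae_have 1 → 2 := by
    rintro ⟨T, hT, c, hc, hD⟩
    obtain ⟨C, hC, h⟩ := τ.exists_expIntegral_le_of_two_mul hd h_zero hT
      (C := (2 * Real.pi) ^ d * c) (by positivity) fun t ht => by
        obtain ⟨p, hp, hpc⟩ := hD ⟨t, (hT.trans ht).le⟩ ht
        rw [mul_assoc]
        exact hτ.expIntegral_two_mul_le hY hp hpc
    refine ⟨2 * T, by positivity, C, hC, fun t ht => ?_⟩
    rw [τ.lintegral_exp_re_charExponent]
    exact h t ht
  tfae_have 2 → 1 := by
    rintro ⟨T, hT, c, hc, hD⟩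
    refine ⟨T, hT, Real.exp (1 / 4) / unitBallVolume d * c,
      mul_pos (div_pos (Real.exp_pos _) (unitBallVolume_pos d)) hc, fun t ht => ?_⟩
    have h := hD t ht
    rw [τ.lintegral_exp_re_charExponent] at h
    rw [mul_assoc]
    exact hτ.exists_density_of_expIntegral_le hY h
  tfae_have 2 → 3 := by
    rintro ⟨T, hT, C, hC, hD⟩
    simp only [τ.lintegral_exp_re_charExponent] at hD
    obtain ⟨c, ⟨hc0, hc1⟩, hlower⟩ :=
      τ.exists_mul_star_le_reExponent_of_expIntegral_le h_zero hT hC hD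
    obtain ⟨α, hα, hscale⟩ := τ.exists_scaling_of_expIntegral_le hd h_zero hT hC hD
    refine ⟨⟨τ.hInv (1 / T), τ.hInv_pos h_zero (one_div_pos.2 hT), min c (1 / 2),
      ⟨lt_min hc0 (by norm_num), (min_le_left _ _).trans hc1⟩, α, hα, fun x hx => ?_,
      fun l r hl hl1 hr hrT => ?_⟩, T + 1, by positivity, ?_⟩
    · rw [τ.re_charExponent]
      refine le_trans ?_ (hlower x hx)
      have := τ.charExponentStar_nonneg (norm_nonneg x)
      gcongr
      exact min_le_left _ _
    · refine (hscale l r hl hl1 hr hrT).trans ?_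
      have := τ.charExponentStar_nonneg hr.le
      have h2 : 2 ≤ 1 / min c (1 / 2) := by
        rw [le_div_iff₀ (lt_min hc0 (by norm_num))]
        linarith [min_le_right c (1 / 2)]
      gcongr
    · rw [hτ.integrable_cexp_iff (by positivity)]
      exact (hD (T + 1) (by linarith)).trans_lt ENNReal.ofReal_lt_top
  tfae_have 3 → 2 := by
    rintro ⟨⟨T, hT, c, hc, α, hα, hlower, hscale⟩, t₀, ht₀, hI⟩
    simp only [τ.lintegral_exp_re_charExponent]
    simp only [τ.re_charExponent] at hlower
    exact τ.exists_expIntegral_le_of_scaling hd h_zero hT hc hα.1 hlower hscale ht₀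
      ((hτ.integrable_cexp_iff ht₀).1 hI)
  tfae_have 3 → 4 := by
    rintro ⟨⟨T, hT, c, hc, α, hα, hlower, hscale⟩, hI⟩
    simp only [τ.re_charExponent] at hlower
    exact ⟨τ.exists_star_le_localExponent hd hT hc hα.1 hlower hscale, hI⟩
  tfae_have 4 → 3 := by
    rintro ⟨⟨T, hT, C, hC, hloc⟩, hI⟩
    obtain ⟨α, hα, hscale⟩ :=
      τ.exists_scaling_of_star_le_localExponent hd (zero_le_one.trans hC) hloc
    have hC0 : 0 < C := by linarith
    refine ⟨⟨T, hT, 1 / (5 * C), ⟨by positivity, ?_⟩, α, hα, fun x hx => ?_,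
      fun l r hl hl1 hr hrT => ?_⟩, hI⟩
    · rw [div_le_one (by positivity)]
      linarith
    · rw [τ.re_charExponent, one_div, inv_mul_le_iff₀ (by positivity)]
      refine (hloc x hx).trans ?_
      have := mul_le_mul_of_nonneg_left (τ.localExponent_le_five_mul_reExponent x) hC0.le
      exact this.trans (le_of_eq (by ring))
    · refine (hscale l r hl hl1 hr hrT).trans ?_
      have := τ.charExponentStar_nonneg hr.le
      rw [one_div_one_div]
      gcongr
      linarith
  tfae_finish
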